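/- All algebras are of the form $\mathbf A=\langle A,\vee,\wedge,{}^*,{}',0,1\rangle$ of type $(2,2,1,1,0,0)$; $x\le y$ abbreviates the identity $x\wedge y\approx x$. A *variety* is a class of such algebras closed under homomorphic images, subalgebras (up to isomorphism) and direct products; $\mathbb V(K)$ is the least variety containing $K$; a variety is *nontrivial* if it has a member with more than one element, and a *subvariety* of $\mathbb W$ is a variety contained in $\mathbb W$. $\mathbf A$ is a *Stone algebra* if $\langle A,\vee,\wedge,0,1\rangle$ is a bounded distributive lattice and $0^*\approx1$, $1^*\approx0$, $(x\vee y)^*\approx x^*\wedge y^*$, $(x\wedge y)^{**}\approx x^{**}\wedge y^{**}$, $x\le x^{**}$, $x^*\wedge x^{**}\approx0$, $x^*\vee x^{**}\approx1$; *dual Stone algebras* are defined dually, with $'$ as the operation. $\mathbf A$ is *dually quasi-De Morgan* if $\langle A,\vee,\wedge,0,1\rangle$ is a bounded distributive lattice and $0'\approx1$, $1'\approx0$, $(x\wedge y)'\approx x'\vee y'$, $(x\vee y)''\approx x''\vee y''$, $x''\le x$. It is a *Kleene algebra* if $\langle A,\vee,\wedge,0,1\rangle$ is a bounded distributive lattice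 and $0'\approx1$, $1'\approx0$, $(x\wedge y)'\approx x'\vee y'$, $x''\approx x$, $x\wedge x'\le y\vee y'$. Let (R1) be the identity $x\wedge x'{}^*{}'\le y\vee y^*$. Consider the following classes. - $\mathbb{AG}$ (Almost Gautama algebras): Stone, dually quasi-De Morgan, (R1), $x^*{}''\approx x^*$ and $(x\wedge x'{}^*)'{}^*\approx x\wedge x'{}^*$. - $\mathbb G$ (Gautama algebras): Stone, dually quasi-De Morgan, (R1) and $x^*{}'\approx x^{**}$. - $\mathbb{BA}$ (Boolean algebras): bounded distributive lattices with $x\wedge x^*\approx0$, $x\vee x^*\approx1$, $x'\approx x^*$. - $\mathbb{RDBLS}\mathrm t$ (regular double Stone algebras): Stone, dual Stone (with $'$ as dual pseudocomplement) and $x\wedge x'\le y\vee y^*$. - $\mathbb{RKLS}\mathrm t$ (regular Kleene Stone algebras): Stone, Kleene and (R1). - $\mathbb{DMBA}=\mathbb V(\mathbf 4_{\mathbf{dmba}})$, where $\mathbf 4_{\mathbf{dmba}}$ is the four-element Boolean lattice with $^*$ the complement and with $'$ exchanging $0$ and $1$ and fixing both atoms. - $\mathbb V(\mathbf 3_{\mathbf{dblst}},\mathbf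 4_{\mathbf{dmba}})$ and $\mathbb V(\mathbf 3_{\mathbf{klst}},\mathbf 4_{\mathbf{dmba}})$, where $\mathbf 3_{\mathbf{dblst}}$ and $\mathbf 3_{\mathbf{klst}}$ are the chain $0<a<1$ with $0^*=1$, $a^*=1^*=0$, $0'=1$, $1'=0$, and with $a'=1$ in $\mathbf 3_{\mathbf{dblst}}$, $a'=a$ in $\mathbf 3_{\mathbf{klst}}$. A class $\mathbb K$ has the *Amalgamation Property* if for all $\mathbf A,\mathbf B,\mathbf C\in\mathbb K$ and embeddings $f:\mathbf A\to\mathbf B$, $g:\mathbf A\to\mathbf C$ there are $\mathbf D\in\mathbb K$ and embeddings $f_1:\mathbf B\to\mathbf D$, $g_1:\mathbf C\to\mathbf D$ with $f_1f=g_1g$. **Theorem.** The nontrivial subvarieties of $\mathbb{AG}$ are exactly the eight classes $\mathbb{BA}$, $\mathbb{RDBLS}\mathrm t$, $\mathbb{RKLS}\mathrm t$, $\mathbb{DMBA}$, $\mathbb G$, $\mathbb V(\mathbf 3_{\mathbf{dblst}},\mathbf 4_{\mathbf{dmba}})$, $\mathbb V(\mathbf 3_{\mathbf{klst}},\mathbf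 4_{\mathbf{dmba}})$ and $\mathbb{AG}$, and these are pairwise distinct. Moreover: 1. $\mathbb{BA}$, $\mathbb{RDBLS}\mathrm t$, $\mathbb{RKLS}\mathrm t$ and $\mathbb{DMBA}$ have the Amalgamation Property; 2. $\mathbb G$, $\mathbb V(\mathbf 3_{\mathbf{dblst}},\mathbf 4_{\mathbf{dmba}})$, $\mathbb V(\mathbf 3_{\mathbf{klst}},\mathbf 4_{\mathbf{dmba}})$ and $\mathbb{AG}$ do not have it. -/

import Mathlib

universe u v

namespace AlmostGautama

/-- The operations of an algebra `⟨A, ∨, ∧, *, ', 0, 1⟩` of type `(2,2,1,1,0,0)`; `∨, ∧, 0, 1` are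
written `⊔, ⊓, ⊥, ⊤`. No law is imposed here: laws are imposed by the varieties below. -/
class Ops (A : Type u) extends Max A, Min A, Bot A, Top A where
  st : A → A
  pr : A → A

postfix:max "⋆" => Ops.st
postfix:max "´" => Ops.pr

/-- A (bundled) algebra of type `(2,2,1,1,0,0)`. -/
structure Alg where
  carrier : Type u
  [ops : Ops carrier]

instance : CoeSort Alg.{u} (Type u) := ⟨Alg.carrier⟩

instance (A : Alg.{u}) : Ops A := A.ops

/-! ### Identities -/

/-- `x ≤ y` in a lattice, as the identity `x ∧ y ≈ x`. -/
def Below {A : Type u} [Ops A] (x y : A) : Prop := x ⊓ y = x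

structure IsBoundedDistribLattice (A : Type u) [Ops A] : Prop where
  sup_comm : ∀ x y : A, x ⊔ y = y ⊔ x
  inf_comm : ∀ x y : A, x ⊓ y = y ⊓ x
  sup_assoc : ∀ x y z : A, (x ⊔ y) ⊔ z = x ⊔ (y ⊔ z)
  inf_assoc : ∀ x y z : A, (x ⊓ y) ⊓ z = x ⊓ (y ⊓ z)
  sup_inf_self : ∀ x y : A, x ⊔ (x ⊓ y) = x
  inf_sup_self : ∀ x y : A, x ⊓ (x ⊔ y) = x
  inf_sup_left : ∀ x y z : A, x ⊓ (y ⊔ z) = (x ⊓ y) ⊔ (x ⊓ z)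
  bot_below : ∀ x : A, Below ⊥ x
  below_top : ∀ x : A, Below x ⊤

/-- `⟨A, ∨, ∧, *, 0, 1⟩` is a Stone algebra. -/
structure IsStone (A : Type u) [Ops A] : Prop extends IsBoundedDistribLattice A where
  bot_st : (⊥ : A)⋆ = ⊤
  top_st : (⊤ : A)⋆ = ⊥
  sup_st : ∀ x y : A, (x ⊔ y)⋆ = x⋆ ⊓ y⋆
  inf_st_st : ∀ x y : A, (x ⊓ y)⋆⋆ = x⋆⋆ ⊓ y⋆⋆
  below_st_st : ∀ x : A, Below x x⋆⋆
  st_inf_st_st : ∀ x : A, x⋆ ⊓ x⋆⋆ = ⊥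
  stone : ∀ x : A, x⋆ ⊔ x⋆⋆ = ⊤

/-- `⟨A, ∨, ∧, ', 0, 1⟩` is a dual Stone algebra (the operation `'` is the dual
pseudocomplement, often written `⁺`). -/
structure IsDualStone (A : Type u) [Ops A] : Prop extends IsBoundedDistribLattice A where
  top_pr : (⊤ : A)´ = ⊥
  bot_pr : (⊥ : A)´ = ⊤
  inf_pr : ∀ x y : A, (x ⊓ y)´ = x´ ⊔ y´
  sup_pr_pr : ∀ x y : A, (x ⊔ y)´´ = x´´ ⊔ y´´
  pr_pr_below : ∀ x : A, Below x´´ x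
  pr_sup_pr_pr : ∀ x : A, x´ ⊔ x´´ = ⊤
  dual_stone : ∀ x : A, x´ ⊓ x´´ = ⊥

/-- `⟨A, ∨, ∧, ', 0, 1⟩` is a Kleene algebra: a De Morgan algebra with `x ∧ x' ≤ y ∨ y'`. -/
structure IsKleene (A : Type u) [Ops A] : Prop extends IsBoundedDistribLattice A where
  bot_pr : (⊥ : A)´ = ⊤
  top_pr : (⊤ : A)´ = ⊥
  inf_pr : ∀ x y : A, (x ⊓ y)´ = x´ ⊔ y´
  pr_pr : ∀ x : A, x´´ = x
  kleene : ∀ x y : A, Below (x ⊓ x´) (y ⊔ y´)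

/-- `⟨A, ∨, ∧, ', 0, 1⟩` is a dually quasi-De Morgan algebra. -/
structure IsDuallyQuasiDeMorgan (A : Type u) [Ops A] : Prop
    extends IsBoundedDistribLattice A where
  bot_pr : (⊥ : A)´ = ⊤
  top_pr : (⊤ : A)´ = ⊥
  inf_pr : ∀ x y : A, (x ⊓ y)´ = x´ ⊔ y´
  sup_pr_pr : ∀ x y : A, (x ⊔ y)´´ = x´´ ⊔ y´´
  pr_pr_below : ∀ x : A, Below x´´ x

/-- The regularity identity (R1): `x ∧ x'*' ≤ y ∨ y*`. -/
def IsRegular (A : Type u) [Ops A] : Prop :=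
  ∀ x y : A, Below (x ⊓ x´⋆´) (y ⊔ y⋆)

/-- Almost Gautama algebras. -/
structure IsAlmostGautama (A : Type u) [Ops A] : Prop where
  stone : IsStone A
  dqd : IsDuallyQuasiDeMorgan A
  regular : IsRegular A
  weak_star_regular : ∀ x : A, x⋆´´ = x⋆
  L1 : ∀ x : A, (x ⊓ x´⋆)´⋆ = x ⊓ x´⋆

/-- Gautama algebras. -/
structure IsGautama (A : Type u) [Ops A] : Prop where
  stone : IsStone A
  dqd : IsDuallyQuasiDeMorgan A
  regular : IsRegular A
  star_regular : ∀ x : A, x⋆´ = x⋆⋆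

/-- Regular double Stone algebras, with `'` as the dual pseudocomplement. -/
structure IsRegularDoubleStone (A : Type u) [Ops A] : Prop where
  stone : IsStone A
  dual_stone : IsDualStone A
  regular : ∀ x y : A, Below (x ⊓ x´) (y ⊔ y⋆)

/-- Regular Kleene Stone algebras. -/
structure IsRegularKleeneStone (A : Type u) [Ops A] : Prop where
  stone : IsStone A
  kleene : IsKleene A
  regular : IsRegular A

/-- Boolean algebras, with both `*` and `'` the Boolean complement. -/
structure IsBoolean (A : Type u) [Ops A] : Prop extends IsBoundedDistribLattice A where
  inf_st : ∀ x : A, x ⊓ x⋆ = ⊥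
  sup_st : ∀ x : A, x ⊔ x⋆ = ⊤
  pr_eq_st : ∀ x : A, x´ = x⋆

/-! ### Homomorphisms, varieties, amalgamation -/

structure IsHom {A : Type u} {B : Type v} [Ops A] [Ops B] (f : A → B) : Prop where
  map_sup : ∀ x y, f (x ⊔ y) = f x ⊔ f y
  map_inf : ∀ x y, f (x ⊓ y) = f x ⊓ f y
  map_st : ∀ x, f x⋆ = (f x)⋆
  map_pr : ∀ x, f x´ = (f x)´
  map_bot : f ⊥ = ⊥
  map_top : f ⊤ = ⊤

/-- An embedding is an injective homomorphism. -/
def IsEmb {A : Type u} {B : Type v} [Ops A] [Ops B] (f : A → B) : Prop :=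
  IsHom f ∧ Function.Injective f

/-- The direct product of a family of algebras. -/
def Alg.prod {I : Type u} (A : I → Alg.{u}) : Alg.{u} where
  carrier := ∀ i, A i
  ops :=
    { max := fun x y i => x i ⊔ y i
      min := fun x y i => x i ⊓ y i
      bot := fun _ => ⊥
      top := fun _ => ⊤
      st := fun x i => (x i)⋆
      pr := fun x i => (x i)´ }

/-- A variety: a class of algebras closed under homomorphic images, (isomorphic copies of)
subalgebras and direct products. -/
structure IsVariety (V : Set Alg.{u}) : Prop where
  image : ∀ A B : Alg.{u}, A ∈ V → ∀ f : A → B, IsHom f → Function.Surjective f → B ∈ V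
  sub : ∀ A B : Alg.{u}, B ∈ V → ∀ f : A → B, IsEmb f → A ∈ V
  prod : ∀ (I : Type u) (A : I → Alg.{u}), (∀ i, A i ∈ V) → Alg.prod A ∈ V

/-- The variety `𝕍(K)` generated by `K`, the least variety containing `K`. -/
def generatedVariety (K : Set Alg.{u}) : Set Alg.{u} :=
  ⋂₀ {V | IsVariety V ∧ K ⊆ V}

/-- `V` is a nontrivial subvariety of `W`: a variety contained in `W` that has a member with
more than one element. -/
def IsNontrivialSubvariety (V W : Set Alg.{u}) : Prop :=
  IsVariety V ∧ V ⊆ W ∧ ∃ A ∈ V, Nontrivial A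

/-- The Amalgamation Property of a class of algebras. -/
def HasAP (V : Set Alg.{u}) : Prop :=
  ∀ A ∈ V, ∀ B ∈ V, ∀ C ∈ V, ∀ (f : A → B) (g : A → C), IsEmb f → IsEmb g →
    ∃ D ∈ V, ∃ (f₁ : B → D) (g₁ : C → D), IsEmb f₁ ∧ IsEmb g₁ ∧ f₁ ∘ f = g₁ ∘ g

/-! ### Three finite algebras -/

/-- `𝟑_dblst`: the chain `0 < 1 < 2` with pseudocomplement and dual pseudocomplement. -/
def threeDblst : Alg.{u} where
  carrier := ULift.{u} (Fin 3)
  ops :=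
    { max := fun x y => ⟨max x.down y.down⟩
      min := fun x y => ⟨min x.down y.down⟩
      bot := ⟨0⟩
      top := ⟨2⟩
      st := fun x => ⟨if x.down = 0 then 2 else 0⟩
      pr := fun x => ⟨if x.down = 2 then 0 else 2⟩ }

/-- `𝟑_klst`: the chain `0 < 1 < 2` with pseudocomplement and the order-reversing involution
`0 ↦ 2`, `1 ↦ 1`, `2 ↦ 0`. -/
def threeKlst : Alg.{u} where
  carrier := ULift.{u} (Fin 3)
  ops :=
    { max := fun x y => ⟨max x.down y.down⟩
      min := fun x y => ⟨min x.down y.down⟩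
      bot := ⟨0⟩
      top := ⟨2⟩
      st := fun x => ⟨if x.down = 0 then 2 else 0⟩
      pr := fun x => ⟨x.down.rev⟩ }

/-- `𝟒_dmba`: the four-element Boolean lattice, `*` the complement, and `'` exchanging `0` and `1`
and fixing the two atoms. -/
def fourDmba : Alg.{u} where
  carrier := ULift.{u} (Bool × Bool)
  ops :=
    { max := fun x y => ⟨(x.down.1 || y.down.1, x.down.2 || y.down.2)⟩
      min := fun x y => ⟨(x.down.1 && y.down.1, x.down.2 && y.down.2)⟩
      bot := ⟨(false, false)⟩
      top := ⟨(true, true)⟩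
      st := fun x => ⟨(!x.down.1, !x.down.2)⟩
      pr := fun x => ⟨(!x.down.2, !x.down.1)⟩ }

/-! ### The eight varieties -/

/-- Boolean algebras. -/
def BA : Set Alg.{u} := {A | IsBoolean A}

/-- Regular double Stone algebras. -/
def RDBLSt : Set Alg.{u} := {A | IsRegularDoubleStone A}

/-- Regular Kleene Stone algebras. -/
def RKLSt : Set Alg.{u} := {A | IsRegularKleeneStone A}

/-- De Morgan Boolean algebras, `𝕍(𝟒_dmba)`. -/
def DMBA : Set Alg.{u} := generatedVariety {fourDmba}

/-- Gautama algebras. -/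
def G : Set Alg.{u} := {A | IsGautama A}

/-- Almost Gautama algebras. -/
def AG : Set Alg.{u} := {A | IsAlmostGautama A}

end AlmostGautama

open AlmostGautama

universe w

namespace AlmostGautama

section Lattice
variable {A : Type u} [Ops A]

/-- The Mathlib lattice underlying an algebra with a bounded distributive lattice reduct. -/
@[reducible] def IsBoundedDistribLattice.lattice (h : IsBoundedDistribLattice A) :
    DistribLattice A where
  sup := (· ⊔ ·)
  le x y := x ⊓ y = x
  inf := (· ⊓ ·)
  le_refl x := by
    have := h.inf_sup_self x (x ⊓ x)
    rwa [h.sup_inf_self] at this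
  le_trans x y z hxy hyz := by rw [← hxy, h.inf_assoc, hyz]
  le_antisymm x y hxy hyx := by rw [← hxy, h.inf_comm, hyx]
  le_sup_left x y := h.inf_sup_self x y
  le_sup_right x y := by rw [h.sup_comm]; exact h.inf_sup_self y x
  sup_le x y z hxz hyz := by
    rw [h.inf_comm, h.inf_sup_left, h.inf_comm z, h.inf_comm z, hxz, hyz]
  inf_le_left x y := by
    have hx : x ⊓ x = x := by
      have := h.inf_sup_self x (x ⊓ x)
      rwa [h.sup_inf_self] at this
    rw [h.inf_comm, ← h.inf_assoc, hx]
  inf_le_right x y := by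
    have hy : y ⊓ y = y := by
      have := h.inf_sup_self y (y ⊓ y)
      rwa [h.sup_inf_self] at this
    rw [h.inf_assoc, hy]
  le_inf x y z hxy hxz := by rw [← h.inf_assoc, hxy, hxz]
  le_sup_inf x y z := by
    have key : (x ⊔ y) ⊓ (x ⊔ z) = x ⊔ y ⊓ z := by
      rw [h.inf_sup_left, h.inf_comm (x ⊔ y) x, h.inf_sup_self, h.inf_comm (x ⊔ y) z,
        h.inf_sup_left, ← h.sup_assoc, h.inf_comm z x, h.sup_inf_self, h.inf_comm z y]
    have hx : ∀ x : A, x ⊓ x = x := fun x => by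
      have := h.inf_sup_self x (x ⊓ x)
      rwa [h.sup_inf_self] at this
    change ((x ⊔ y) ⊓ (x ⊔ z)) ⊓ (x ⊔ y ⊓ z) = (x ⊔ y) ⊓ (x ⊔ z)
    rw [key, hx]

@[reducible] def IsBoundedDistribLattice.boundedOrder (h : IsBoundedDistribLattice A) :
    letI := h.lattice
    BoundedOrder A :=
  letI := h.lattice
  { toTop := inferInstance
    toBot := inferInstance
    le_top := h.below_top
    bot_le := h.bot_below }

namespace IsStone
variable (h : IsStone A)
include h

theorem inf_st_self (x : A) : x ⊓ x⋆ = ⊥ := by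
  let _ := h.lattice
  let _ := h.boundedOrder
  have h1 : x ≤ x⋆⋆ := h.below_st_st x
  have h2 : x⋆ ⊓ x⋆⋆ = ⊥ := h.st_inf_st_st x
  apply le_antisymm _ bot_le
  rw [← h2, inf_comm x]
  exact inf_le_inf_left _ h1

theorem st_anti {x y : A} (hxy : Below x y) : Below y⋆ x⋆ := by
  let _ := h.lattice
  let _ := h.boundedOrder
  have h1 : x ≤ y := hxy
  have h2 := h.sup_st x y
  rw [show x ⊔ y = y from sup_eq_right.2 h1] at h2
  change y⋆ ≤ x⋆
  rw [h2]
  exact inf_le_left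

theorem st_st_st (x : A) : x⋆⋆⋆ = x⋆ := by
  let _ := h.lattice
  exact le_antisymm (h.st_anti (h.below_st_st x)) (h.below_st_st x⋆)

theorem st_eq_of_isCompl {x y : A} (hi : x ⊓ y = ⊥) (hs : x ⊔ y = ⊤) : x⋆ = y := by
  let _ := h.lattice
  let _ := h.boundedOrder
  have h1 : x⋆ ⊓ y⋆ = ⊥ := by rw [← h.sup_st, hs, h.top_st]
  have hd : y ≤ x⋆ := by
    have h3 : x⋆⋆ ⊓ y⋆⋆ = ⊥ := by rw [← h.inf_st_st, hi, h.bot_st, h.top_st]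
    have h4 : x⋆ ⊔ x⋆⋆ = ⊤ := h.stone x
    have h5 : y ≤ y⋆⋆ := h.below_st_st y
    refine h5.trans ?_
    calc y⋆⋆ = y⋆⋆ ⊓ (x⋆ ⊔ x⋆⋆) := by rw [h4, inf_top_eq]
      _ = (y⋆⋆ ⊓ x⋆) ⊔ (y⋆⋆ ⊓ x⋆⋆) := inf_sup_left _ _ _
      _ = y⋆⋆ ⊓ x⋆ := by rw [inf_comm y⋆⋆ x⋆⋆, h3, sup_bot_eq]
      _ ≤ x⋆ := inf_le_right
  apply le_antisymm _ hd
  calc x⋆ = x⋆ ⊓ (x ⊔ y) := by rw [hs, inf_top_eq]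
    _ = (x⋆ ⊓ x) ⊔ (x⋆ ⊓ y) := inf_sup_left _ _ _
    _ = x⋆ ⊓ y := by rw [inf_comm x⋆ x, h.inf_st_self, bot_sup_eq]
    _ ≤ y := inf_le_right

theorem inf_st (x y : A) : (x ⊓ y)⋆ = x⋆ ⊔ y⋆ := by
  let _ := h.lattice
  let _ := h.boundedOrder
  rw [← h.st_st_st, h.inf_st_st]
  apply h.st_eq_of_isCompl
  · rw [inf_sup_left, inf_right_comm, inf_comm x⋆⋆ x⋆, h.st_inf_st_st, inf_assoc,
      inf_comm y⋆⋆ y⋆, h.st_inf_st_st]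
    simp
  · apply le_antisymm le_top
    rw [sup_inf_right]
    apply le_inf
    · rw [← h.stone x, sup_comm x⋆ x⋆⋆]
      exact sup_le_sup_left le_sup_left _
    · rw [← h.stone y, sup_comm y⋆ y⋆⋆]
      exact sup_le_sup_left le_sup_right _

theorem below_of_inf_st_eq_bot {x y : A} (hy : y⋆⋆ = y) (hxy : x ⊓ y⋆ = ⊥) : Below x y := by
  let _ := h.lattice
  let _ := h.boundedOrder
  have hs : y⋆ ⊔ y = ⊤ := by simpa only [hy] using h.stone y
  change x ≤ y
  calc x = x ⊓ (y⋆ ⊔ y) := by rw [hs, inf_top_eq]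
    _ = x ⊓ y := by rw [inf_sup_left, hxy, bot_sup_eq]
    _ ≤ y := inf_le_right

end IsStone

namespace IsDuallyQuasiDeMorgan
variable (h : IsDuallyQuasiDeMorgan A)
include h

theorem pr_anti {x y : A} (hxy : Below x y) : Below y´ x´ := by
  let _ := h.lattice
  have h2 := h.inf_pr x y
  rw [show x ⊓ y = x from hxy] at h2
  change y´ ≤ x´
  rw [h2]
  exact le_sup_right

theorem pr_pr_pr (x : A) : x´´´ = x´ := by
  let _ := h.lattice
  exact le_antisymm (h.pr_pr_below x´) (h.pr_anti (h.pr_pr_below x))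

end IsDuallyQuasiDeMorgan

end Lattice
section Inclusions
variable {A : Type u} [Ops A]

theorem IsGautama.isAlmostGautama (h : IsGautama A) : IsAlmostGautama A := by
  let _ := h.stone.lattice
  let _ := h.stone.boundedOrder
  refine ⟨h.stone, h.dqd, h.regular, fun x => ?_, fun x => ?_⟩
  · rw [h.star_regular, h.star_regular, h.stone.st_st_st]
  · have hle : x´⋆ ≤ x := by
      have h1 : x´⋆´ = x´⋆⋆ := h.star_regular x´
      have h2 : x´⋆´ ⊔ x´´ = ⊤ := by
        rw [← h.dqd.inf_pr, inf_comm, h.stone.inf_st_self, h.dqd.bot_pr]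
      have h3 : x´´ ≤ x := h.dqd.pr_pr_below x
      refine le_trans ?_ h3
      calc x´⋆ = x´⋆ ⊓ (x´⋆´ ⊔ x´´) := by rw [h2, inf_top_eq]
        _ = x´⋆ ⊓ x´´ := by
          rw [inf_sup_left, h1, h.stone.st_inf_st_st, bot_sup_eq]
        _ ≤ x´´ := inf_le_right
    rw [show x ⊓ x´⋆ = x´⋆ from inf_eq_right.2 hle, h.star_regular, h.stone.st_st_st]

theorem IsRegularDoubleStone.isGautama (h : IsRegularDoubleStone A) : IsGautama A := by
  let _ := h.stone.lattice
  let _ := h.stone.boundedOrder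
  have hd : IsDuallyQuasiDeMorgan A :=
    { h.dual_stone with }
  refine ⟨h.stone, hd, fun x y => ?_, fun x => ?_⟩
  · rw [h.stone.st_eq_of_isCompl (h.dual_stone.dual_stone x) (h.dual_stone.pr_sup_pr_pr x),
      hd.pr_pr_pr]
    exact h.regular x y
  · have hi := h.stone.st_inf_st_st x
    have hs := h.stone.stone x
    generalize x⋆ = y at *
    generalize hz : y⋆ = z at *
    apply le_antisymm
    · have h1 : y´´ ⊔ z´´ = ⊤ := by rw [← hd.sup_pr_pr, hs, hd.top_pr, hd.bot_pr]
      have h2 : z´´ ≤ z := hd.pr_pr_below z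
      refine le_trans ?_ h2
      calc y´ = y´ ⊓ (y´´ ⊔ z´´) := by rw [h1, inf_top_eq]
        _ = y´ ⊓ z´´ := by rw [inf_sup_left, h.dual_stone.dual_stone, bot_sup_eq]
        _ ≤ z´´ := inf_le_right
    · have h1 : y´ ⊔ y = ⊤ := by
        apply le_antisymm le_top
        rw [← h.dual_stone.pr_sup_pr_pr y]
        exact sup_le_sup_left (hd.pr_pr_below y) _
      calc z = z ⊓ (y´ ⊔ y) := by rw [h1, inf_top_eq]
        _ = z ⊓ y´ := by rw [inf_sup_left, inf_comm z y, hi, sup_bot_eq]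
        _ ≤ y´ := inf_le_right

theorem IsRegularKleeneStone.isGautama (h : IsRegularKleeneStone A) : IsGautama A := by
  let _ := h.stone.lattice
  let _ := h.stone.boundedOrder
  have hd : IsDuallyQuasiDeMorgan A :=
    { h.kleene with
      sup_pr_pr := fun _ _ => by simp only [h.kleene.pr_pr]
      pr_pr_below := fun x => by rw [h.kleene.pr_pr]; exact le_refl x }
  refine ⟨h.stone, hd, h.regular, fun x => ?_⟩
  have hi := h.stone.st_inf_st_st x
  have hs := h.stone.stone x
  have h3 : x⋆´ ⊓ x⋆⋆´ = ⊥ := by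
    rw [← h.kleene.pr_pr (x⋆´ ⊓ x⋆⋆´), hd.inf_pr, h.kleene.pr_pr, h.kleene.pr_pr, hs, hd.top_pr]
  have h4 : x⋆ ⊓ x⋆´ = ⊥ := by
    have hk : x⋆ ⊓ x⋆´ ≤ x⋆⋆ ⊔ x⋆⋆´ := h.kleene.kleene _ _
    apply le_antisymm _ bot_le
    calc x⋆ ⊓ x⋆´ ≤ (x⋆ ⊓ x⋆´) ⊓ (x⋆⋆ ⊔ x⋆⋆´) := le_inf le_rfl hk
      _ ≤ (x⋆ ⊓ x⋆⋆) ⊔ (x⋆´ ⊓ x⋆⋆´) := by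
        rw [inf_sup_left]
        exact sup_le_sup (inf_le_inf_right _ inf_le_left) (inf_le_inf_right _ inf_le_right)
      _ = ⊥ := by rw [hi, h3, sup_bot_eq]
  have h5 : x⋆ ⊔ x⋆´ = ⊤ := by
    have := hd.inf_pr x⋆ x⋆´
    rw [h4, hd.bot_pr, h.kleene.pr_pr] at this
    rw [sup_comm, ← this]
  exact (h.stone.st_eq_of_isCompl h4 h5).symm

theorem IsBoolean.isGautama (h : IsBoolean A) : IsGautama A := by
  let _ := h.lattice
  let _ := h.boundedOrder
  have hc (x : A) : IsCompl x x⋆ := IsCompl.of_eq (h.inf_st x) (h.sup_st x)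
  have hu {x y : A} (hxy : IsCompl x y) : x⋆ = y := (hc x).right_unique hxy
  have hss (x : A) : x⋆⋆ = x := hu (hc x).symm
  have hb : (⊥ : A)⋆ = ⊤ := hu isCompl_bot_top
  have ht : (⊤ : A)⋆ = ⊥ := hu isCompl_top_bot
  have hinf (x y : A) : (x ⊓ y)⋆ = x⋆ ⊔ y⋆ := hu ((hc x).inf_sup (hc y))
  have hsup (x y : A) : (x ⊔ y)⋆ = x⋆ ⊓ y⋆ := hu ((hc x).sup_inf (hc y))
  refine ⟨{ h.toIsBoundedDistribLattice with
      bot_st := hb, top_st := ht, sup_st := hsup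
      inf_st_st := fun x y => by simp only [hss]
      below_st_st := fun x => by rw [hss]; exact le_refl x
      st_inf_st_st := fun _ => h.inf_st _
      stone := fun _ => h.sup_st _ },
    { h.toIsBoundedDistribLattice with
      bot_pr := by rw [h.pr_eq_st, hb]
      top_pr := by rw [h.pr_eq_st, ht]
      inf_pr := fun x y => by simp only [h.pr_eq_st, hinf]
      sup_pr_pr := fun _ _ => by simp only [h.pr_eq_st, hss]
      pr_pr_below := fun x => by simp only [h.pr_eq_st, hss]; exact le_refl x }, fun x y => ?_,
    fun x => h.pr_eq_st _⟩
  rw [h.sup_st y]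
  exact h.below_top _

end Inclusions

section Preservation

theorem Alg.isHom_proj {I : Type u} (A : I → Alg.{u}) (i : I) :
    IsHom (fun x : Alg.prod A => x i) :=
  ⟨fun _ _ => rfl, fun _ _ => rfl, fun _ => rfl, fun _ => rfl, rfl, rfl⟩

theorem IsVariety.sInter {K : Set (Set Alg.{u})} (hK : ∀ V ∈ K, IsVariety V) :
    IsVariety (⋂₀ K) where
  image A B hA f hf hs V hV := (hK V hV).image A B (hA V hV) f hf hs
  sub A B hB f hf V hV := (hK V hV).sub A B (hB V hV) f hf
  prod I A hA V hV := (hK V hV).prod I A fun i => hA i V hV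

theorem isVariety_generatedVariety (K : Set Alg.{u}) : IsVariety (generatedVariety K) :=
  IsVariety.sInter fun _ h => h.1

theorem subset_generatedVariety (K : Set Alg.{u}) : K ⊆ generatedVariety K :=
  fun _ hA _ hV => hV.2 hA

theorem generatedVariety_subset {K V : Set Alg.{u}} (hV : IsVariety V) (hK : K ⊆ V) :
    generatedVariety K ⊆ V :=
  fun _ hA => hA V ⟨hV, hK⟩

/-- Terms in the language of type `(2,2,1,1,0,0)` in three variables. -/
inductive Term
  | var (i : Fin 3)
  | bot
  | top
  | sup (s t : Term)
  | inf (s t : Term)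
  | st (t : Term)
  | pr (t : Term)

namespace Term

def eval {A : Type u} [Ops A] (v : Fin 3 → A) : Term → A
  | var i => v i
  | bot => ⊥
  | top => ⊤
  | sup s t => s.eval v ⊔ t.eval v
  | inf s t => s.eval v ⊓ t.eval v
  | st t => (t.eval v)⋆
  | pr t => (t.eval v)´

theorem eval_hom {A : Type u} {B : Type v} [Ops A] [Ops B] {f : A → B} (hf : IsHom f)
    (v : Fin 3 → A) (t : Term) : t.eval (fun i => f (v i)) = f (t.eval v) := by
  induction t with
  | var i => rfl
  | bot => exact hf.map_bot.symm
  | top => exact hf.map_top.symm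
  | sup s t hs ht => simp only [eval, hs, ht, hf.map_sup]
  | inf s t hs ht => simp only [eval, hs, ht, hf.map_inf]
  | st t ht => simp only [eval, ht, hf.map_st]
  | pr t ht => simp only [eval, ht, hf.map_pr]

end Term

/-- The class of models of a list of identities. -/
def models (E : List (Term × Term)) : Set Alg.{u} :=
  {A | ∀ e ∈ E, ∀ x y z : A, e.1.eval ![x, y, z] = e.2.eval ![x, y, z]}

theorem isVariety_models (E : List (Term × Term)) : IsVariety (models.{u} E) := by
  have hev {A B : Alg.{u}} {f : A → B} (hf : IsHom f) (x y z : A) (t : Term) :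
      t.eval ![f x, f y, f z] = f (t.eval ![x, y, z]) := by
    rw [← Term.eval_hom hf]
    congr 1
    funext i
    fin_cases i <;> rfl
  refine ⟨fun A B hA f hf hs e he x y z => ?_, fun A B hB f hf e he x y z => ?_,
    fun I A hA e he x y z => funext fun i => ?_⟩
  · obtain ⟨x, rfl⟩ := hs x
    obtain ⟨y, rfl⟩ := hs y
    obtain ⟨z, rfl⟩ := hs z
    rw [hev hf, hev hf, hA e he]
  · apply hf.2
    rw [← hev hf.1, ← hev hf.1, hB e he]
  · have hp := Alg.isHom_proj A i
    exact (hev hp x y z e.1).symm.trans ((hA i e he _ _ _).trans (hev hp x y z e.2))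

@[simp] theorem mem_models_nil (A : Alg.{u}) : A ∈ models [] := by simp [models]

@[simp] theorem mem_models_cons (A : Alg.{u}) (e : Term × Term) (E : List (Term × Term)) :
    A ∈ models (e :: E) ↔
      (∀ x y z : A, e.1.eval ![x, y, z] = e.2.eval ![x, y, z]) ∧ A ∈ models E := by
  simp [models]

theorem mem_models_append (A : Alg.{u}) (E F : List (Term × Term)) :
    A ∈ models (E ++ F) ↔ A ∈ models E ∧ A ∈ models F := by
  simp only [models, Set.mem_ofPred_eq, List.mem_append, or_imp, forall_and]

namespace Term

instance : Ops Term where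
  max := sup
  min := inf
  bot := bot
  top := top
  st := st
  pr := pr

abbrev x : Term := var 0
abbrev y : Term := var 1
abbrev z : Term := var 2

def latticeAxioms : List (Term × Term) :=
  [(x ⊔ y, y ⊔ x), (x ⊓ y, y ⊓ x), ((x ⊔ y) ⊔ z, x ⊔ (y ⊔ z)), ((x ⊓ y) ⊓ z, x ⊓ (y ⊓ z)),
    (x ⊔ (x ⊓ y), x), (x ⊓ (x ⊔ y), x), (x ⊓ (y ⊔ z), (x ⊓ y) ⊔ (x ⊓ z)), (⊥ ⊓ x, ⊥),
    (x ⊓ ⊤, x)]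

def stoneAxioms : List (Term × Term) :=
  latticeAxioms ++ [(⊥⋆, ⊤), (⊤⋆, ⊥), ((x ⊔ y)⋆, x⋆ ⊓ y⋆), ((x ⊓ y)⋆⋆, x⋆⋆ ⊓ y⋆⋆),
    (x ⊓ x⋆⋆, x), (x⋆ ⊓ x⋆⋆, ⊥), (x⋆ ⊔ x⋆⋆, ⊤)]

def dualStoneAxioms : List (Term × Term) :=
  latticeAxioms ++ [(⊤´, ⊥), (⊥´, ⊤), ((x ⊓ y)´, x´ ⊔ y´), ((x ⊔ y)´´, x´´ ⊔ y´´),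
    (x´´ ⊓ x, x´´), (x´ ⊔ x´´, ⊤), (x´ ⊓ x´´, ⊥)]

def kleeneAxioms : List (Term × Term) :=
  latticeAxioms ++ [(⊥´, ⊤), (⊤´, ⊥), ((x ⊓ y)´, x´ ⊔ y´), (x´´, x),
    ((x ⊓ x´) ⊓ (y ⊔ y´), x ⊓ x´)]

def duallyQuasiDeMorganAxioms : List (Term × Term) :=
  latticeAxioms ++ [(⊥´, ⊤), (⊤´, ⊥), ((x ⊓ y)´, x´ ⊔ y´), ((x ⊔ y)´´, x´´ ⊔ y´´),
    (x´´ ⊓ x, x´´)]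

/-- The identity (R1). -/
abbrev regularAxiom : Term × Term :=
  ((x ⊓ x´⋆´) ⊓ (y ⊔ y⋆), x ⊓ x´⋆´)

end Term

open Term

section Axiomatizations
variable {A : Alg.{u}}

theorem mem_models_latticeAxioms :
    A ∈ models latticeAxioms ↔ IsBoundedDistribLattice A := by
  simp only [latticeAxioms, mem_models_cons, mem_models_nil, and_true]
  exact ⟨fun ⟨h1, h2, h3, h4, h5, h6, h7, h8, h9⟩ =>
      ⟨fun x y => h1 x y x, fun x y => h2 x y x, h3, h4, fun x y => h5 x y x,
        fun x y => h6 x y x, h7, fun x => h8 x x x, fun x => h9 x x x⟩,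
    fun ⟨h1, h2, h3, h4, h5, h6, h7, h8, h9⟩ =>
      ⟨fun x y _ => h1 x y, fun x y _ => h2 x y, h3, h4, fun x y _ => h5 x y,
        fun x y _ => h6 x y, h7, fun x _ _ => h8 x, fun x _ _ => h9 x⟩⟩

theorem mem_models_stoneAxioms : A ∈ models stoneAxioms ↔ IsStone A := by
  simp only [stoneAxioms, mem_models_append, mem_models_latticeAxioms, mem_models_cons,
    mem_models_nil, and_true]
  exact ⟨fun ⟨h0, h1, h2, h3, h4, h5, h6, h7⟩ =>
      ⟨h0, h1 ⊥ ⊥ ⊥, h2 ⊥ ⊥ ⊥, fun x y => h3 x y x, fun x y => h4 x y x, fun x => h5 x x x,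
        fun x => h6 x x x, fun x => h7 x x x⟩,
    fun ⟨h0, h1, h2, h3, h4, h5, h6, h7⟩ =>
      ⟨h0, fun _ _ _ => h1, fun _ _ _ => h2, fun x y _ => h3 x y, fun x y _ => h4 x y,
        fun x _ _ => h5 x, fun x _ _ => h6 x, fun x _ _ => h7 x⟩⟩

theorem mem_models_dualStoneAxioms : A ∈ models dualStoneAxioms ↔ IsDualStone A := by
  simp only [dualStoneAxioms, mem_models_append, mem_models_latticeAxioms, mem_models_cons,
    mem_models_nil, and_true]
  exact ⟨fun ⟨h0, h1, h2, h3, h4, h5, h6, h7⟩ =>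
      ⟨h0, h1 ⊥ ⊥ ⊥, h2 ⊥ ⊥ ⊥, fun x y => h3 x y x, fun x y => h4 x y x, fun x => h5 x x x,
        fun x => h6 x x x, fun x => h7 x x x⟩,
    fun ⟨h0, h1, h2, h3, h4, h5, h6, h7⟩ =>
      ⟨h0, fun _ _ _ => h1, fun _ _ _ => h2, fun x y _ => h3 x y, fun x y _ => h4 x y,
        fun x _ _ => h5 x, fun x _ _ => h6 x, fun x _ _ => h7 x⟩⟩

theorem mem_models_kleeneAxioms : A ∈ models kleeneAxioms ↔ IsKleene A := by
  simp only [kleeneAxioms, mem_models_append, mem_models_latticeAxioms, mem_models_cons,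
    mem_models_nil, and_true]
  exact ⟨fun ⟨h0, h1, h2, h3, h4, h5⟩ =>
      ⟨h0, h1 ⊥ ⊥ ⊥, h2 ⊥ ⊥ ⊥, fun x y => h3 x y x, fun x => h4 x x x, fun x y => h5 x y x⟩,
    fun ⟨h0, h1, h2, h3, h4, h5⟩ =>
      ⟨h0, fun _ _ _ => h1, fun _ _ _ => h2, fun x y _ => h3 x y, fun x _ _ => h4 x,
        fun x y _ => h5 x y⟩⟩

theorem mem_models_duallyQuasiDeMorganAxioms :
    A ∈ models duallyQuasiDeMorganAxioms ↔ IsDuallyQuasiDeMorgan A := by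
  simp only [duallyQuasiDeMorganAxioms, mem_models_append, mem_models_latticeAxioms,
    mem_models_cons, mem_models_nil, and_true]
  exact ⟨fun ⟨h0, h1, h2, h3, h4, h5⟩ =>
      ⟨h0, h1 ⊥ ⊥ ⊥, h2 ⊥ ⊥ ⊥, fun x y => h3 x y x, fun x y => h4 x y x, fun x => h5 x x x⟩,
    fun ⟨h0, h1, h2, h3, h4, h5⟩ =>
      ⟨h0, fun _ _ _ => h1, fun _ _ _ => h2, fun x y _ => h3 x y, fun x y _ => h4 x y,
        fun x _ _ => h5 x⟩⟩

end Axiomatizations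

theorem isVariety_BA : IsVariety BA.{u} := by
  convert isVariety_models (latticeAxioms ++ [(x ⊓ x⋆, ⊥), (x ⊔ x⋆, ⊤), (x´, x⋆)])
  ext A
  simp only [mem_models_append, mem_models_latticeAxioms, mem_models_cons, mem_models_nil,
    and_true]
  exact ⟨fun ⟨h0, h1, h2, h3⟩ => ⟨h0, fun x _ _ => h1 x, fun x _ _ => h2 x, fun x _ _ => h3 x⟩,
    fun ⟨h0, h1, h2, h3⟩ => ⟨h0, fun x => h1 x x x, fun x => h2 x x x, fun x => h3 x x x⟩⟩

theorem isVariety_RDBLSt : IsVariety RDBLSt.{u} := by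
  convert isVariety_models
    (stoneAxioms ++ (dualStoneAxioms ++ [((x ⊓ x´) ⊓ (y ⊔ y⋆), x ⊓ x´)]))
  ext A
  simp only [mem_models_append, mem_models_stoneAxioms, mem_models_dualStoneAxioms,
    mem_models_cons, mem_models_nil, and_true]
  exact ⟨fun ⟨h0, h1, h2⟩ => ⟨h0, h1, fun x y _ => h2 x y⟩,
    fun ⟨h0, h1, h2⟩ => ⟨h0, h1, fun x y => h2 x y x⟩⟩

theorem isVariety_RKLSt : IsVariety RKLSt.{u} := by
  convert isVariety_models (stoneAxioms ++ (kleeneAxioms ++ [regularAxiom]))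
  ext A
  simp only [mem_models_append, mem_models_stoneAxioms, mem_models_kleeneAxioms,
    mem_models_cons, mem_models_nil, and_true]
  exact ⟨fun ⟨h0, h1, h2⟩ => ⟨h0, h1, fun x y _ => h2 x y⟩,
    fun ⟨h0, h1, h2⟩ => ⟨h0, h1, fun x y => h2 x y x⟩⟩

theorem isVariety_G : IsVariety G.{u} := by
  convert isVariety_models
    (stoneAxioms ++ (duallyQuasiDeMorganAxioms ++ [regularAxiom, (x⋆´, x⋆⋆)]))
  ext A
  simp only [mem_models_append, mem_models_stoneAxioms, mem_models_duallyQuasiDeMorganAxioms,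
    mem_models_cons, mem_models_nil, and_true]
  exact ⟨fun ⟨h0, h1, h2, h3⟩ => ⟨h0, h1, fun x y _ => h2 x y, fun x _ _ => h3 x⟩,
    fun ⟨h0, h1, h2, h3⟩ => ⟨h0, h1, fun x y => h2 x y x, fun x => h3 x x x⟩⟩

theorem isVariety_AG : IsVariety AG.{u} := by
  convert isVariety_models (stoneAxioms ++ (duallyQuasiDeMorganAxioms ++
    [regularAxiom, (x⋆´´, x⋆), ((x ⊓ x´⋆)´⋆, x ⊓ x´⋆)]))
  ext A
  simp only [mem_models_append, mem_models_stoneAxioms, mem_models_duallyQuasiDeMorganAxioms,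
    mem_models_cons, mem_models_nil, and_true]
  exact ⟨fun ⟨h0, h1, h2, h3, h4⟩ =>
      ⟨h0, h1, fun x y _ => h2 x y, fun x _ _ => h3 x, fun x _ _ => h4 x⟩,
    fun ⟨h0, h1, h2, h3, h4⟩ =>
      ⟨h0, h1, fun x y => h2 x y x, fun x => h3 x x x, fun x => h4 x x x⟩⟩

end Preservation

/-- Central elements: complemented elements whose complement is given by both `*` and `'`. -/
structure IsCentral {A : Type u} [Ops A] (z : A) : Prop where
  st_st : z⋆⋆ = z
  pr : z´ = z⋆

theorem IsCentral.map {A : Type u} {B : Type v} [Ops A] [Ops B] {f : A → B} (hf : IsHom f) {z : A}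
    (hz : IsCentral z) : IsCentral (f z) :=
  ⟨by rw [← hf.map_st, ← hf.map_st, hz.st_st], by rw [← hf.map_st, ← hf.map_pr, hz.pr]⟩

namespace IsAlmostGautama
variable {A : Type u} [Ops A] (h : IsAlmostGautama A)
include h

theorem isCentral_top : IsCentral (⊤ : A) :=
  ⟨by rw [h.stone.top_st, h.stone.bot_st], by rw [h.stone.top_st, h.dqd.top_pr]⟩

theorem isCentral_inf {z w : A} (hz : IsCentral z) (hw : IsCentral w) : IsCentral (z ⊓ w) :=
  ⟨by rw [h.stone.inf_st_st, hz.st_st, hw.st_st],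
    by rw [h.stone.inf_st, h.dqd.inf_pr, hz.pr, hw.pr]⟩

theorem isCentral_st {z : A} (hz : IsCentral z) : IsCentral z⋆ :=
  ⟨h.stone.st_st_st z, by
    have := h.weak_star_regular z⋆
    rw [hz.st_st] at this
    rw [← hz.pr, this, hz.pr, hz.st_st]⟩

theorem isCentral_inf_pr_st (x : A) : IsCentral (x ⊓ x´⋆) := by
  let _ := h.stone.lattice
  let _ := h.stone.boundedOrder
  have he := h.L1 x
  generalize x ⊓ x´⋆ = e at he
  have hee : e⋆⋆ = e := by rw [← he, h.stone.st_st_st]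
  have hle : e´ ≤ e⋆ := by
    have : e´ ≤ e´⋆⋆ := h.stone.below_st_st e´
    rwa [he] at this
  refine ⟨hee, le_antisymm hle ?_⟩
  have h2 : e ≤ e⋆´ := by
    have h3 : e´ ⊔ e⋆´ = ⊤ := by
      rw [← h.dqd.inf_pr, h.stone.inf_st_self, h.dqd.bot_pr]
    have h4 : e ⊓ e´ = ⊥ := by
      apply le_antisymm _ bot_le
      rw [← h.stone.inf_st_self e]
      exact inf_le_inf_left _ hle
    calc e = e ⊓ (e´ ⊔ e⋆´) := by rw [h3, inf_top_eq]
      _ = e ⊓ e⋆´ := by rw [inf_sup_left, h4, bot_sup_eq]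
      _ ≤ e⋆´ := inf_le_right
  have h5 : e⋆´´ ≤ e´ := h.dqd.pr_anti h2
  rwa [h.weak_star_regular] at h5

theorem st_inf (a z : A) : a⋆ ⊓ z = (a ⊓ z)⋆ ⊓ z := by
  let _ := h.stone.lattice
  let _ := h.stone.boundedOrder
  rw [h.stone.inf_st, inf_sup_right, inf_comm z⋆, h.stone.inf_st_self, sup_bot_eq]

theorem pr_inf_central (a : A) {z : A} (hz : IsCentral z) : a´ ⊓ z = (a ⊓ z)´ ⊓ z := by
  let _ := h.stone.lattice
  let _ := h.stone.boundedOrder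
  rw [h.dqd.inf_pr, inf_sup_right, hz.pr, inf_comm z⋆, h.stone.inf_st_self, sup_bot_eq]

end IsAlmostGautama

/-- Sets of central elements containing `⊤` and closed under meets. -/
structure IsCentralFilter {A : Type u} [Ops A] (F : Set A) : Prop where
  central : ∀ z ∈ F, IsCentral z
  top_mem : ⊤ ∈ F
  inf_mem : ∀ z ∈ F, ∀ w ∈ F, z ⊓ w ∈ F

/-- The quotient by the congruence of a filter of central elements. -/
theorem IsAlmostGautama.exists_quotient {A : Alg.{u}} (h : IsAlmostGautama A) {F : Set A}
    (hF : IsCentralFilter F) :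
    ∃ (Q : Alg.{u}) (q : A → Q), IsHom q ∧ Function.Surjective q ∧
      ∀ x y, q x = q y ↔ ∃ z ∈ F, x ⊓ z = y ⊓ z := by
  let _ := h.stone.lattice
  have restrict {x y z w : A} (hxy : x ⊓ z = y ⊓ z) : x ⊓ (z ⊓ w) = y ⊓ (z ⊓ w) := by
    rw [← inf_assoc, hxy, inf_assoc]
  let s : Setoid A :=
    { r := fun x y => ∃ z ∈ F, x ⊓ z = y ⊓ z
      iseqv :=
        { refl := fun x => ⟨⊤, hF.top_mem, rfl⟩
          symm := fun ⟨z, hz, hxy⟩ => ⟨z, hz, hxy.symm⟩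
          trans := fun ⟨z, hz, hxy⟩ ⟨w, hw, hyw⟩ => ⟨z ⊓ w, hF.inf_mem z hz w hw,
            (restrict hxy).trans (by rw [inf_comm z w]; exact restrict hyw)⟩ } }
  have hsup : ∀ a b : A, a ≈ b → ∀ c d : A, c ≈ d → a ⊔ c ≈ b ⊔ d := by
    rintro a b ⟨z, hz, hab⟩ c d ⟨w, hw, hcd⟩
    refine ⟨z ⊓ w, hF.inf_mem z hz w hw, ?_⟩
    rw [inf_sup_right, inf_sup_right, restrict hab, inf_comm z w, restrict hcd]
  have hinf : ∀ a b : A, a ≈ b → ∀ c d : A, c ≈ d → a ⊓ c ≈ b ⊓ d := by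
    rintro a b ⟨z, hz, hab⟩ c d ⟨w, hw, hcd⟩
    refine ⟨z ⊓ w, hF.inf_mem z hz w hw, ?_⟩
    rw [inf_inf_inf_comm, hab, hcd, inf_inf_inf_comm]
  have hst : ∀ a b : A, a ≈ b → a⋆ ≈ b⋆ := by
    rintro a b ⟨z, hz, hab⟩
    refine ⟨z, hz, ?_⟩
    rw [h.st_inf a z, hab, ← h.st_inf b z]
  have hpr : ∀ a b : A, a ≈ b → a´ ≈ b´ := by
    rintro a b ⟨z, hz, hab⟩
    refine ⟨z, hz, ?_⟩
    rw [h.pr_inf_central a (hF.central z hz), hab, ← h.pr_inf_central b (hF.central z hz)]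
  let _ : Ops (Quotient s) :=
    { max := Quotient.map₂ (· ⊔ ·) fun a b hab c d hcd => hsup a b hab c d hcd
      min := Quotient.map₂ (· ⊓ ·) fun a b hab c d hcd => hinf a b hab c d hcd
      bot := ⟦⊥⟧
      top := ⟦⊤⟧
      st := Quotient.map (·⋆) hst
      pr := Quotient.map (·´) hpr }
  exact ⟨⟨Quotient s⟩, fun x => (⟦x⟧ : Quotient s),
    ⟨fun _ _ => rfl, fun _ _ => rfl, fun _ => rfl, fun _ => rfl, rfl, rfl⟩,
    Quotient.mk_surjective, fun x y => Quotient.eq⟩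

theorem IsAlmostGautama.exists_maximal_filter {A : Type u} [Ops A] (h : IsAlmostGautama A)
    {F₀ : Set A} (hF₀ : IsCentralFilter F₀) {x y : A} (hxy : ∀ z ∈ F₀, x ⊓ z ≠ y ⊓ z) :
    ∃ F, F₀ ⊆ F ∧ IsCentralFilter F ∧ (∀ z ∈ F, x ⊓ z ≠ y ⊓ z) ∧
      ∀ z, IsCentral z → z ∈ F ∨ z⋆ ∈ F := by
  let _ := h.stone.lattice
  let _ := h.stone.boundedOrder
  obtain ⟨F, hFF, hF⟩ := zorn_subset_nonempty
    {F : Set A | IsCentralFilter F ∧ ∀ z ∈ F, x ⊓ z ≠ y ⊓ z}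
    (by
      intro c hc hch hne
      obtain ⟨F₁, hF₁⟩ := hne
      refine ⟨⋃₀ c, ⟨⟨?_, ?_, ?_⟩, ?_⟩, fun s hs => Set.subset_sUnion_of_mem hs⟩
      · rintro z ⟨s, hs, hz⟩
        exact (hc hs).1.central z hz
      · exact ⟨F₁, hF₁, (hc hF₁).1.top_mem⟩
      · rintro z ⟨s, hs, hz⟩ w ⟨t, ht, hw⟩
        rcases hch.total hs ht with hst | hts
        · exact ⟨t, ht, (hc ht).1.inf_mem z (hst hz) w hw⟩
        · exact ⟨s, hs, (hc hs).1.inf_mem z hz w (hts hw)⟩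
      · rintro z ⟨s, hs, hz⟩
        exact (hc hs).2 z hz)
    F₀ ⟨hF₀, hxy⟩
  have key : ∀ z, IsCentral z → z ∈ F ∨ ∃ w ∈ F, x ⊓ (w ⊓ z) = y ⊓ (w ⊓ z) := by
    intro z hz
    by_contra! hcon
    have hmem : {u : A | IsCentral u ∧ ∃ w ∈ F, w ⊓ z ≤ u} ∈
        {F : Set A | IsCentralFilter F ∧ ∀ z ∈ F, x ⊓ z ≠ y ⊓ z} := by
      refine ⟨⟨fun u hu => hu.1, ⟨h.isCentral_top, ⊤, hF.prop.1.top_mem, le_top⟩, ?_⟩, ?_⟩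
      · rintro u ⟨hu, w, hw, hwu⟩ v ⟨hv, w', hw', hwv⟩
        exact ⟨h.isCentral_inf hu hv, w ⊓ w', hF.prop.1.inf_mem w hw w' hw',
          le_inf ((inf_le_inf_right _ inf_le_left).trans hwu)
            ((inf_le_inf_right _ inf_le_right).trans hwv)⟩
      · rintro u ⟨hu, w, hw, hwu⟩ heq
        apply hcon.2 w hw
        rw [← inf_eq_right.2 hwu, ← inf_assoc, heq, inf_assoc]
    exact hcon.1 (hF.le_of_ge hmem
      (fun u hu => ⟨hF.prop.1.central u hu, u, hu, inf_le_left⟩)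
      ⟨hz, ⊤, hF.prop.1.top_mem, inf_le_right⟩)
  refine ⟨F, hFF, hF.prop.1, hF.prop.2, fun z hz => ?_⟩
  rcases key z hz with hzF | ⟨w, hw, h1⟩
  · exact Or.inl hzF
  rcases key z⋆ (h.isCentral_st hz) with hzF | ⟨w', hw', h2⟩
  · exact Or.inr hzF
  exfalso
  apply hF.prop.2 _ (hF.prop.1.inf_mem w hw w' hw')
  have hs : z ⊔ z⋆ = ⊤ := by simpa only [hz.st_st, sup_comm] using h.stone.stone z
  have hw1 : w ⊓ w' = (w ⊓ z) ⊓ w' ⊔ (w' ⊓ z⋆) ⊓ w := by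
    rw [inf_right_comm, inf_right_comm w', inf_comm w' w, ← inf_sup_left, hs, inf_top_eq]
  rw [hw1, inf_sup_left, inf_sup_left, ← inf_assoc, h1, inf_assoc, ← inf_assoc x, h2, inf_assoc y]

/-- Nontrivial almost Gautama algebras in which `x ∧ x'* = 0` whenever `x ≠ 1`; these are the
simple algebras of the variety. -/
structure IsSimpleAG (Q : Type u) [Ops Q] : Prop where
  ag : IsAlmostGautama Q
  bot_ne_top : (⊥ : Q) ≠ ⊤
  inf_pr_st : ∀ x : Q, x ≠ ⊤ → x ⊓ x´⋆ = ⊥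

theorem IsAlmostGautama.exists_simple_quotient {A : Alg.{u}} (h : IsAlmostGautama A)
    {F₀ : Set A} (hF₀ : IsCentralFilter F₀) {x y : A} (hxy : ∀ z ∈ F₀, x ⊓ z ≠ y ⊓ z) :
    ∃ (Q : Alg.{u}) (q : A → Q), IsSimpleAG Q ∧ IsHom q ∧ Function.Surjective q ∧ q x ≠ q y ∧
      ∀ z ∈ F₀, q z = ⊤ := by
  let _ := h.stone.lattice
  let _ := h.stone.boundedOrder
  obtain ⟨F, hFF, hF, hsep, hult⟩ := h.exists_maximal_filter hF₀ hxy
  obtain ⟨Q, q, hq, hqs, hker⟩ := h.exists_quotient hF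
  have hne : q x ≠ q y := fun heq => by
    obtain ⟨z, hz, hz'⟩ := (hker x y).1 heq
    exact hsep z hz hz'
  have htop : ∀ z ∈ F, q z = ⊤ := fun z hz => by
    rw [← hq.map_top, hker]
    exact ⟨z, hz, by rw [inf_idem, top_inf_eq]⟩
  refine ⟨Q, q, ⟨isVariety_AG.image A Q h q hq hqs, ?_, ?_⟩, hq, hqs, hne,
    fun z hz => htop z (hFF hz)⟩
  · intro heq
    apply hne
    rw [← hq.map_bot, ← hq.map_top, hker] at heq
    obtain ⟨z, hz, hz'⟩ := heq
    rw [bot_inf_eq, top_inf_eq] at hz'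
    exact (hker x y).2 ⟨z, hz, by rw [← hz', inf_bot_eq, inf_bot_eq]⟩
  · intro t ht
    obtain ⟨a, rfl⟩ := hqs t
    rw [← hq.map_pr, ← hq.map_st, ← hq.map_inf]
    have hc := h.isCentral_inf_pr_st a
    rcases hult _ hc with hm | hm
    · refine (ht ?_).elim
      rw [← hq.map_top, hker]
      exact ⟨_, hm, by rw [← inf_assoc, inf_idem, top_inf_eq]⟩
    · rw [← hq.map_bot, hker]
      exact ⟨_, hm, by rw [h.stone.inf_st_self, bot_inf_eq]⟩

/-- The two-element Boolean algebra. -/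
def two : Alg.{u} where
  carrier := ULift.{u} Bool
  ops :=
    { max := fun x y => ⟨x.down || y.down⟩
      min := fun x y => ⟨x.down && y.down⟩
      bot := ⟨false⟩
      top := ⟨true⟩
      st := fun x => ⟨!x.down⟩
      pr := fun x => ⟨!x.down⟩ }

/-- `S` and `B` are isomorphic. -/
def Iso (S B : Alg.{u}) : Prop := ∃ g : S → B, IsHom g ∧ Function.Bijective g

theorem Iso.symm {S B : Alg.{u}} (h : Iso S B) : Iso B S := by
  obtain ⟨g, hg, hb⟩ := h
  obtain ⟨k, hl, hr⟩ := Function.bijective_iff_has_inverse.1 hb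
  refine ⟨k, ⟨fun x y => hb.1 ?_, fun x y => hb.1 ?_, fun x => hb.1 ?_, fun x => hb.1 ?_,
    hb.1 ?_, hb.1 ?_⟩, hr.injective, hl.surjective⟩
  · rw [hg.map_sup, hr, hr, hr]
  · rw [hg.map_inf, hr, hr, hr]
  · rw [hg.map_st, hr, hr]
  · rw [hg.map_pr, hr, hr]
  · rw [hg.map_bot, hr]
  · rw [hg.map_top, hr]

theorem Iso.mem {V : Set Alg.{u}} (hV : IsVariety V) {S B : Alg.{u}} (h : Iso S B) (hS : S ∈ V) :
    B ∈ V := by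
  obtain ⟨g, hg, hb⟩ := h
  exact hV.image S B hS g hg hb.2

theorem iso_two {Q : Alg.{u}} (h : IsAlmostGautama Q) (hbt : (⊥ : Q) ≠ ⊤)
    (hall : ∀ x : Q, x = ⊥ ∨ x = ⊤) : Iso two Q := by
  let _ := h.stone.lattice
  let _ := h.stone.boundedOrder
  refine ⟨fun x => if x.down then ⊤ else ⊥, ⟨?_, ?_, ?_, ?_, rfl, rfl⟩, ?_, ?_⟩
  · rintro ⟨_ | _⟩ ⟨_ | _⟩ <;> simp [two] <;> rfl
  · rintro ⟨_ | _⟩ ⟨_ | _⟩ <;> simp [two] <;> rfl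
  · rintro ⟨_ | _⟩ <;> simp [two, h.stone.bot_st, h.stone.top_st] <;> rfl
  · rintro ⟨_ | _⟩ <;> simp [two, h.dqd.bot_pr, h.dqd.top_pr] <;> rfl
  · rintro ⟨_ | _⟩ ⟨_ | _⟩ <;> simp [hbt, hbt.symm] <;> rfl
  · intro x
    rcases hall x with rfl | rfl
    exacts [⟨⟨false⟩, rfl⟩, ⟨⟨true⟩, rfl⟩]

theorem iso_threeDblst {Q : Alg.{u}} (h : IsAlmostGautama Q) (hbt : (⊥ : Q) ≠ ⊤) {a : Q}
    (hb : a ≠ ⊥) (ht : a ≠ ⊤) (hst : a⋆ = ⊥) (hpr : a´ = ⊤)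
    (hall : ∀ x : Q, x = ⊥ ∨ x = a ∨ x = ⊤) : Iso threeDblst Q := by
  let _ := h.stone.lattice
  let _ := h.stone.boundedOrder
  refine ⟨fun x => ![⊥, a, ⊤] x.down, ⟨?_, ?_, ?_, ?_, rfl, rfl⟩, ?_, ?_⟩
  · rintro ⟨x⟩ ⟨y⟩
    fin_cases x <;> fin_cases y <;> simp [threeDblst] <;> rfl
  · rintro ⟨x⟩ ⟨y⟩
    fin_cases x <;> fin_cases y <;> simp [threeDblst] <;> rfl
  · rintro ⟨x⟩
    fin_cases x <;> simp [threeDblst, h.stone.bot_st, h.stone.top_st, hst] <;> rfl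
  · rintro ⟨x⟩
    fin_cases x <;> simp [threeDblst, h.dqd.bot_pr, h.dqd.top_pr, hpr] <;> rfl
  · rintro ⟨x⟩ ⟨y⟩
    fin_cases x <;> fin_cases y <;> simp [hbt, hbt.symm, hb, hb.symm, ht, ht.symm] <;> rfl
  · intro x
    rcases hall x with rfl | rfl | rfl
    exacts [⟨⟨0⟩, rfl⟩, ⟨⟨1⟩, rfl⟩, ⟨⟨2⟩, rfl⟩]

theorem iso_threeKlst {Q : Alg.{u}} (h : IsAlmostGautama Q) (hbt : (⊥ : Q) ≠ ⊤) {a : Q}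
    (hb : a ≠ ⊥) (ht : a ≠ ⊤) (hst : a⋆ = ⊥) (hpr : a´ = a)
    (hall : ∀ x : Q, x = ⊥ ∨ x = a ∨ x = ⊤) : Iso threeKlst Q := by
  let _ := h.stone.lattice
  let _ := h.stone.boundedOrder
  refine ⟨fun x => ![⊥, a, ⊤] x.down, ⟨?_, ?_, ?_, ?_, rfl, rfl⟩, ?_, ?_⟩
  · rintro ⟨x⟩ ⟨y⟩
    fin_cases x <;> fin_cases y <;> simp [threeKlst] <;> rfl
  · rintro ⟨x⟩ ⟨y⟩
    fin_cases x <;> fin_cases y <;> simp [threeKlst] <;> rfl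
  · rintro ⟨x⟩
    fin_cases x <;> simp [threeKlst, h.stone.bot_st, h.stone.top_st, hst] <;> rfl
  · rintro ⟨x⟩
    fin_cases x <;> simp [threeKlst, h.dqd.bot_pr, h.dqd.top_pr, hpr] <;> rfl
  · rintro ⟨x⟩ ⟨y⟩
    fin_cases x <;> fin_cases y <;> simp [hbt, hbt.symm, hb, hb.symm, ht, ht.symm] <;> rfl
  · intro x
    rcases hall x with rfl | rfl | rfl
    exacts [⟨⟨0⟩, rfl⟩, ⟨⟨1⟩, rfl⟩, ⟨⟨2⟩, rfl⟩]

theorem iso_fourDmba {Q : Alg.{u}} (h : IsAlmostGautama Q) (hbt : (⊥ : Q) ≠ ⊤) {b : Q}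
    (hb : b ≠ ⊥) (ht : b ≠ ⊤) (hst : b⋆⋆ = b) (hpr : b´ = b) (hpr' : b⋆´ = b⋆)
    (hall : ∀ x : Q, x = ⊥ ∨ x = b ∨ x = b⋆ ∨ x = ⊤) : Iso fourDmba Q := by
  let _ := h.stone.lattice
  let _ := h.stone.boundedOrder
  have hi : b ⊓ b⋆ = ⊥ := h.stone.inf_st_self b
  have hs : b ⊔ b⋆ = ⊤ := by simpa only [hst, sup_comm] using h.stone.stone b
  have hi' : b⋆ ⊓ b = ⊥ := by rw [inf_comm, hi]
  have hs' : b⋆ ⊔ b = ⊤ := by rw [sup_comm, hs]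
  have hb' : b⋆ ≠ ⊥ := fun hc => ht (by rw [← hst, hc, h.stone.bot_st])
  have ht' : b⋆ ≠ ⊤ := fun hc => hb (by rw [← hst, hc, h.stone.top_st])
  have hne : b ≠ b⋆ := fun hc => hb (by rw [← hi, ← hc, inf_idem])
  refine ⟨fun x => if x.down.1 then (if x.down.2 then ⊤ else b) else (if x.down.2 then b⋆ else ⊥),
    ⟨?_, ?_, ?_, ?_, rfl, rfl⟩, ?_, ?_⟩
  · rintro ⟨_ | _, _ | _⟩ ⟨_ | _, _ | _⟩ <;> simp [fourDmba, hs, hs'] <;> rfl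
  · rintro ⟨_ | _, _ | _⟩ ⟨_ | _, _ | _⟩ <;> simp [fourDmba, hi, hi'] <;> rfl
  · rintro ⟨_ | _, _ | _⟩ <;> simp [fourDmba, h.stone.bot_st, h.stone.top_st, hst] <;> rfl
  · rintro ⟨_ | _, _ | _⟩ <;> simp [fourDmba, h.dqd.bot_pr, h.dqd.top_pr, hpr, hpr'] <;> rfl
  · rintro ⟨_ | _, _ | _⟩ ⟨_ | _, _ | _⟩ <;>
      simp [hbt, hbt.symm, hb, hb.symm, ht, ht.symm, hb', hb'.symm, ht', ht'.symm, hne, hne.symm] <;>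
      rfl
  · intro x
    rcases hall x with rfl | rfl | rfl | rfl
    exacts [⟨⟨false, false⟩, rfl⟩, ⟨⟨true, false⟩, rfl⟩, ⟨⟨false, true⟩, rfl⟩,
      ⟨⟨true, true⟩, rfl⟩]

namespace IsSimpleAG
variable {Q : Alg.{u}} (h : IsSimpleAG Q)
include h

theorem below_pr_st_st {x : Q} (hx : x ≠ ⊤) : Below x x´⋆⋆ :=
  h.ag.stone.below_of_inf_st_eq_bot (h.ag.stone.st_st_st _) (by
    rw [h.ag.stone.st_st_st]
    exact h.inf_pr_st x hx)

theorem pr_ne_bot {x : Q} (hx : x ≠ ⊤) : x´ ≠ ⊥ := by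
  let _ := h.ag.stone.lattice
  let _ := h.ag.stone.boundedOrder
  intro hc
  have h1 := h.inf_pr_st x hx
  rw [hc, h.ag.stone.bot_st, inf_top_eq] at h1
  rw [h1, h.ag.dqd.bot_pr] at hc
  exact h.bot_ne_top hc.symm

/-- In a simple algebra `'` fixes every proper nonzero element of the Boolean skeleton. -/
theorem pr_eq_self {b : Q} (hb : b⋆⋆ = b) (h0 : b ≠ ⊥) (h1 : b ≠ ⊤) : b´ = b := by
  let _ := h.ag.stone.lattice
  let _ := h.ag.stone.boundedOrder
  have key : ∀ c : Q, c⋆⋆ = c → c ≠ ⊥ → c ≠ ⊤ → c´ ≤ c := by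
    intro c hc hc0 hc1
    have hpp : c´´ = c := by rw [← hc, h.ag.weak_star_regular]
    have hne : c´ ≠ ⊤ := fun hcon => hc0 (by rw [← hpp, hcon, h.ag.dqd.top_pr])
    have h2 := h.inf_pr_st c´ hne
    rw [hpp] at h2
    exact h.ag.stone.below_of_inf_st_eq_bot hc h2
  have hb' := key b hb h0 h1
  have hs0 : b⋆ ≠ ⊥ := fun hc => h1 (by rw [← hb, hc, h.ag.stone.bot_st])
  have hs1 : b⋆ ≠ ⊤ := fun hc => h0 (by rw [← hb, hc, h.ag.stone.top_st])
  have hbs : b⋆´ ≤ b⋆ := key b⋆ (h.ag.stone.st_st_st b) hs0 hs1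
  have hi : b ⊓ b⋆ = ⊥ := h.ag.stone.inf_st_self b
  have hs : b´ ⊔ b⋆´ = ⊤ := by rw [← h.ag.dqd.inf_pr, hi, h.ag.dqd.bot_pr]
  apply le_antisymm hb'
  calc b = b ⊓ (b´ ⊔ b⋆´) := by rw [hs, inf_top_eq]
    _ ≤ b´ ⊔ (b ⊓ b⋆) := by
      rw [inf_sup_left]
      exact sup_le_sup inf_le_right (inf_le_inf_left _ hbs)
    _ = b´ := by rw [hi, sup_bot_eq]

theorem skeleton_antichain {b d : Q} (hb : b⋆⋆ = b) (hd : d⋆⋆ = d) (h0 : b ≠ ⊥) (h1 : d ≠ ⊤)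
    (hbd : Below b d) : b = d := by
  let _ := h.ag.stone.lattice
  let _ := h.ag.stone.boundedOrder
  have hle : b ≤ d := hbd
  have hb1 : b ≠ ⊤ := fun hc => h1 (top_le_iff.1 (hc ▸ hle))
  have hd0 : d ≠ ⊥ := fun hc => h0 (le_bot_iff.1 (hc ▸ hle))
  have h2 : d´ ≤ b´ := h.ag.dqd.pr_anti hbd
  rw [h.pr_eq_self hb h0 hb1, h.pr_eq_self hd hd0 h1] at h2
  exact le_antisymm hle h2

theorem eq_top_of_dense {b : Q} (hb : b⋆⋆ = b) (h0 : b ≠ ⊥) (h1 : b ≠ ⊤) {y : Q} (hy : y⋆ = ⊥) :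
    y = ⊤ := by
  let _ := h.ag.stone.lattice
  let _ := h.ag.stone.boundedOrder
  have key : ∀ c : Q, c⋆⋆ = c → c ≠ ⊥ → c ≠ ⊤ → y ⊔ c = ⊤ := by
    intro c hc hc0 hc1
    by_contra hne
    have h2 : (y ⊔ c)´ ≤ c := by
      have : (y ⊔ c)´ ≤ c´ := h.ag.dqd.pr_anti (le_sup_right : c ≤ y ⊔ c)
      rwa [h.pr_eq_self hc hc0 hc1] at this
    have h3 : (y ⊔ c)´⋆⋆ ≤ c := by
      have : (y ⊔ c)´⋆⋆ ≤ c⋆⋆ := h.ag.stone.st_anti (h.ag.stone.st_anti h2)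
      rwa [hc] at this
    have h4 : y ⊔ c ≤ c := le_trans (h.below_pr_st_st hne) h3
    have h5 : y ≤ c := le_sup_left.trans h4
    have h6 : c⋆ ≤ y⋆ := h.ag.stone.st_anti h5
    rw [hy, le_bot_iff] at h6
    exact hc1 (by rw [← hc, h6, h.ag.stone.bot_st])
  have hs0 : b⋆ ≠ ⊥ := fun hc => h1 (by rw [← hb, hc, h.ag.stone.bot_st])
  have hs1 : b⋆ ≠ ⊤ := fun hc => h0 (by rw [← hb, hc, h.ag.stone.top_st])
  have e1 := key b hb h0 h1
  have e2 := key b⋆ (h.ag.stone.st_st_st b) hs0 hs1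
  rw [← sup_bot_eq (a := y), ← h.ag.stone.inf_st_self b, sup_inf_left, e1, e2, inf_top_eq]

theorem iso_fourDmba_of_skeleton {b : Q} (hb : b⋆⋆ = b) (h0 : b ≠ ⊥) (h1 : b ≠ ⊤) :
    Iso fourDmba Q := by
  let _ := h.ag.stone.lattice
  let _ := h.ag.stone.boundedOrder
  have hs0 : b⋆ ≠ ⊥ := fun hc => h1 (by rw [← hb, hc, h.ag.stone.bot_st])
  have hs1 : b⋆ ≠ ⊤ := fun hc => h0 (by rw [← hb, hc, h.ag.stone.top_st])
  have hbs := h.ag.stone.st_st_st b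
  have hreg : ∀ x : Q, x⋆⋆ = x := by
    intro x
    have hd : x ⊔ x⋆ = ⊤ := by
      apply h.eq_top_of_dense hb h0 h1
      rw [h.ag.stone.sup_st, h.ag.stone.st_inf_st_st]
    exact h.ag.stone.st_eq_of_isCompl (by rw [inf_comm]; exact h.ag.stone.inf_st_self x)
      (by rw [sup_comm]; exact hd)
  refine iso_fourDmba h.ag h.bot_ne_top h0 h1 hb (h.pr_eq_self hb h0 h1)
    (h.pr_eq_self hbs hs0 hs1) fun x => ?_
  by_cases hx0 : x ⊓ b = ⊥
  · have hle : x ≤ b⋆ := h.ag.stone.below_of_inf_st_eq_bot hbs (by rw [hb]; exact hx0)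
    by_cases hx : x = ⊥
    · exact Or.inl hx
    · exact Or.inr (Or.inr (Or.inl (h.skeleton_antichain (hreg x) hbs hx hs1 hle)))
  · have hxb : x ⊓ b = b :=
      h.skeleton_antichain (hreg _) hb hx0 h1 (inf_le_right : x ⊓ b ≤ b)
    by_cases hx : x = ⊤
    · exact Or.inr (Or.inr (Or.inr hx))
    · exact Or.inr (Or.inl (h.skeleton_antichain hb (hreg x) h0 hx (inf_eq_right.1 hxb)).symm)

theorem iso_chain (hsk : ∀ b : Q, b⋆⋆ = b → b = ⊥ ∨ b = ⊤) :
    Iso two Q ∨ Iso threeDblst Q ∨ Iso threeKlst Q := by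
  let _ := h.ag.stone.lattice
  let _ := h.ag.stone.boundedOrder
  have hst : ∀ x : Q, x ≠ ⊥ → x⋆ = ⊥ := by
    intro x hx
    rcases hsk x⋆ (h.ag.stone.st_st_st x) with h1 | h1
    · exact h1
    · have := h.ag.stone.inf_st_self x
      rw [h1, inf_top_eq] at this
      exact (hx this).elim
  have hle : ∀ x y : Q, x ≠ ⊤ → y ≠ ⊥ → x ≤ y := by
    intro x y hx hy
    have := h.ag.regular x y
    rw [hst _ (h.pr_ne_bot hx), h.ag.dqd.bot_pr, hst y hy, inf_top_eq, sup_bot_eq] at this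
    exact this
  by_cases hex : ∃ a : Q, a ≠ ⊥ ∧ a ≠ ⊤
  · obtain ⟨a, h0, h1⟩ := hex
    have hall : ∀ x : Q, x = ⊥ ∨ x = a ∨ x = ⊤ := fun x => by
      by_cases hx0 : x = ⊥
      · exact Or.inl hx0
      by_cases hx1 : x = ⊤
      · exact Or.inr (Or.inr hx1)
      exact Or.inr (Or.inl (le_antisymm (hle x a hx1 h0) (hle a x h1 hx0)))
    rcases hall a´ with hp | hp | hp
    · exact (h.pr_ne_bot h1 hp).elim
    · exact Or.inr (Or.inr (iso_threeKlst h.ag h.bot_ne_top h0 h1 (hst a h0) hp hall))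
    · exact Or.inr (Or.inl (iso_threeDblst h.ag h.bot_ne_top h0 h1 (hst a h0) hp hall))
  · refine Or.inl (iso_two h.ag h.bot_ne_top fun x => ?_)
    by_contra! hx
    exact hex ⟨x, hx⟩

theorem iso_cases : Iso two Q ∨ Iso threeDblst Q ∨ Iso threeKlst Q ∨ Iso fourDmba Q := by
  by_cases hex : ∃ b : Q, b⋆⋆ = b ∧ b ≠ ⊥ ∧ b ≠ ⊤
  · obtain ⟨b, hb, h0, h1⟩ := hex
    exact Or.inr (Or.inr (Or.inr (h.iso_fourDmba_of_skeleton hb h0 h1)))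
  · have := h.iso_chain fun b hb => by
      by_contra! hx
      exact hex ⟨b, hb, hx⟩
    tauto

end IsSimpleAG

instance {A : Type u} [Ops A] [DecidableEq A] (x y : A) : Decidable (Below x y) :=
  inferInstanceAs (Decidable (x ⊓ y = x))

instance : Fintype two.{u} := inferInstanceAs (Fintype (ULift Bool))
instance : DecidableEq two.{u} := inferInstanceAs (DecidableEq (ULift Bool))
instance : Fintype threeDblst.{u} := inferInstanceAs (Fintype (ULift (Fin 3)))
instance : DecidableEq threeDblst.{u} := inferInstanceAs (DecidableEq (ULift (Fin 3)))
instance : Fintype threeKlst.{u} := inferInstanceAs (Fintype (ULift (Fin 3)))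
instance : DecidableEq threeKlst.{u} := inferInstanceAs (DecidableEq (ULift (Fin 3)))
instance : Fintype fourDmba.{u} := inferInstanceAs (Fintype (ULift (Bool × Bool)))
instance : DecidableEq fourDmba.{u} := inferInstanceAs (DecidableEq (ULift (Bool × Bool)))

theorem two_mem_BA : two.{u} ∈ BA := by
  refine ⟨⟨?_, ?_, ?_, ?_, ?_, ?_, ?_, ?_, ?_⟩, ?_, ?_, ?_⟩ <;> decide

theorem threeDblst_mem_RDBLSt : threeDblst.{u} ∈ RDBLSt := by
  have hl : IsBoundedDistribLattice threeDblst.{u} := by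
    refine ⟨?_, ?_, ?_, ?_, ?_, ?_, ?_, ?_, ?_⟩ <;> decide
  refine ⟨⟨hl, ?_, ?_, ?_, ?_, ?_, ?_, ?_⟩, ⟨hl, ?_, ?_, ?_, ?_, ?_, ?_, ?_⟩, ?_⟩ <;> decide

theorem threeKlst_mem_RKLSt : threeKlst.{u} ∈ RKLSt := by
  have hl : IsBoundedDistribLattice threeKlst.{u} := by
    refine ⟨?_, ?_, ?_, ?_, ?_, ?_, ?_, ?_, ?_⟩ <;> decide
  refine ⟨⟨hl, ?_, ?_, ?_, ?_, ?_, ?_, ?_⟩, ⟨hl, ?_, ?_, ?_, ?_, ?_⟩, ?_⟩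
  rotate_right
  · unfold IsRegular
    decide
  all_goals decide

theorem fourDmba_mem_AG : fourDmba.{u} ∈ AG := by
  have hl : IsBoundedDistribLattice fourDmba.{u} := by
    refine ⟨?_, ?_, ?_, ?_, ?_, ?_, ?_, ?_, ?_⟩ <;> decide
  refine ⟨⟨hl, ?_, ?_, ?_, ?_, ?_, ?_, ?_⟩, ⟨hl, ?_, ?_, ?_, ?_, ?_⟩, ?_, ?_, ?_⟩
  rotate_right 3
  · unfold IsRegular
    decide
  all_goals decide

theorem G_subset_AG : G.{u} ⊆ AG := fun _ h => IsGautama.isAlmostGautama h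
theorem BA_subset_G : BA.{u} ⊆ G := fun _ h => IsBoolean.isGautama h
theorem RDBLSt_subset_G : RDBLSt.{u} ⊆ G := fun _ h => IsRegularDoubleStone.isGautama h
theorem RKLSt_subset_G : RKLSt.{u} ⊆ G := fun _ h => IsRegularKleeneStone.isGautama h

theorem threeDblst_mem_G : threeDblst.{u} ∈ G := RDBLSt_subset_G threeDblst_mem_RDBLSt
theorem threeKlst_mem_G : threeKlst.{u} ∈ G := RKLSt_subset_G threeKlst_mem_RKLSt
theorem threeDblst_mem_AG : threeDblst.{u} ∈ AG := G_subset_AG threeDblst_mem_G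
theorem threeKlst_mem_AG : threeKlst.{u} ∈ AG := G_subset_AG threeKlst_mem_G

theorem fourDmba_notMem_G : fourDmba.{u} ∉ G := fun h => by
  have := h.star_regular
  revert this
  decide

theorem threeDblst_notMem_BA : threeDblst.{u} ∉ BA := fun h => by
  have := h.sup_st
  revert this
  decide

theorem threeKlst_notMem_BA : threeKlst.{u} ∉ BA := fun h => by
  have := h.sup_st
  revert this
  decide

theorem threeKlst_notMem_RDBLSt : threeKlst.{u} ∉ RDBLSt := fun h => by
  have := h.dual_stone.dual_stone
  revert this
  decide

theorem threeDblst_notMem_RKLSt : threeDblst.{u} ∉ RKLSt := fun h => by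
  have := h.kleene.pr_pr
  revert this
  decide

section
open Term

/-- Identities of the generators hold in the generated variety. -/
theorem generatedVariety_satisfies {K : Set Alg.{u}} {s t : Term}
    (hK : ∀ A ∈ K, ∀ x y z : A, s.eval ![x, y, z] = t.eval ![x, y, z]) {A : Alg.{u}}
    (hA : A ∈ generatedVariety K) (x y z : A) : s.eval ![x, y, z] = t.eval ![x, y, z] :=
  generatedVariety_subset (isVariety_models [(s, t)]) (fun A hA => by simpa using hK A hA) hA
    (s, t) (by simp) x y z

theorem st_st_of_mem_DMBA {A : Alg.{u}} (hA : A ∈ DMBA) (a : A) : a⋆⋆ = a := by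
  refine generatedVariety_satisfies (s := x⋆⋆) (t := x) ?_ hA a a a
  rintro _ rfl x _ _
  revert x
  change ∀ x : fourDmba, x⋆⋆ = x
  decide

theorem pr_pr_of_mem_generatedVariety {A : Alg.{u}}
    (hA : A ∈ generatedVariety {threeKlst, fourDmba}) (a : A) : a´´ = a := by
  refine generatedVariety_satisfies (s := x´´) (t := x) ?_ hA a a a
  rintro _ (rfl | rfl) x _ _ <;> revert x
  · change ∀ x : threeKlst, x´´ = x
    decide
  · change ∀ x : fourDmba, x´´ = x
    decide

theorem pr_pr_st_st_of_mem_generatedVariety {A : Alg.{u}}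
    (hA : A ∈ generatedVariety {threeDblst, fourDmba}) (a : A) : a´´⋆⋆ = a´´ := by
  refine generatedVariety_satisfies (s := x´´⋆⋆) (t := x´´) ?_ hA a a a
  rintro _ (rfl | rfl) x _ _ <;> revert x
  · change ∀ x : threeDblst, x´´⋆⋆ = x´´
    decide
  · change ∀ x : fourDmba, x´´⋆⋆ = x´´
    decide

end

theorem threeDblst_notMem_DMBA : threeDblst.{u} ∉ DMBA := fun h => by
  have := st_st_of_mem_DMBA h
  revert this
  decide

theorem threeKlst_notMem_DMBA : threeKlst.{u} ∉ DMBA := fun h => by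
  have := st_st_of_mem_DMBA h
  revert this
  decide

theorem threeKlst_notMem_generatedVariety :
    threeKlst.{u} ∉ generatedVariety {threeDblst, fourDmba} := fun h => by
  have := pr_pr_st_st_of_mem_generatedVariety h
  revert this
  decide

theorem threeDblst_notMem_generatedVariety :
    threeDblst.{u} ∉ generatedVariety {threeKlst, fourDmba} := fun h => by
  have := pr_pr_of_mem_generatedVariety h
  revert this
  decide

instance : Nontrivial two.{u} := inferInstanceAs (Nontrivial (ULift Bool))
instance : Nontrivial threeDblst.{u} := inferInstanceAs (Nontrivial (ULift (Fin 3)))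
instance : Nontrivial threeKlst.{u} := inferInstanceAs (Nontrivial (ULift (Fin 3)))
instance : Nontrivial fourDmba.{u} := inferInstanceAs (Nontrivial (ULift (Bool × Bool)))

theorem IsAlmostGautama.bot_ne_top {A : Type u} [Ops A] (h : IsAlmostGautama A) [Nontrivial A] :
    (⊥ : A) ≠ ⊤ := by
  let _ := h.stone.lattice
  let _ := h.stone.boundedOrder
  exact _root_.bot_ne_top

theorem exists_emb_two {A : Alg.{u}} (h : IsAlmostGautama A) [Nontrivial A] :
    ∃ f : two → A, IsEmb f := by
  let _ := h.stone.lattice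
  let _ := h.stone.boundedOrder
  refine ⟨fun x => if x.down then ⊤ else ⊥, ⟨?_, ?_, ?_, ?_, rfl, rfl⟩, ?_⟩
  · rintro ⟨_ | _⟩ ⟨_ | _⟩ <;> simp <;> rfl
  · rintro ⟨_ | _⟩ ⟨_ | _⟩ <;> simp <;> rfl
  · rintro ⟨_ | _⟩ <;> simp [h.stone.bot_st, h.stone.top_st] <;> rfl
  · rintro ⟨_ | _⟩ <;> simp [h.dqd.bot_pr, h.dqd.top_pr] <;> rfl
  · rintro ⟨_ | _⟩ ⟨_ | _⟩ <;> simp <;> rfl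

theorem IsNontrivialSubvariety.two_mem {V : Set Alg.{u}} (hV : IsNontrivialSubvariety V AG) :
    two ∈ V := by
  obtain ⟨A, hA, hnt⟩ := hV.2.2
  obtain ⟨f, hf⟩ := exists_emb_two (hV.2.1 hA)
  exact hV.1.sub two A hA f hf

/-- Distinct elements of an almost Gautama algebra are separated in a simple quotient. -/
theorem IsAlmostGautama.exists_simple_quotient_separating {A : Alg.{u}} (h : IsAlmostGautama A)
    {x y : A} (hxy : x ≠ y) :
    ∃ (Q : Alg.{u}) (q : A → Q), IsSimpleAG Q ∧ IsHom q ∧ Function.Surjective q ∧ q x ≠ q y := by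
  let _ := h.stone.lattice
  let _ := h.stone.boundedOrder
  obtain ⟨Q, q, hQ, hq, hs, hne, -⟩ := h.exists_simple_quotient (F₀ := {⊤}) (x := x) (y := y)
    ⟨fun z hz => by rw [Set.mem_singleton_iff.1 hz]; exact h.isCentral_top, rfl,
      fun z hz w hw => by
        rw [Set.mem_singleton_iff.1 hz, Set.mem_singleton_iff.1 hw]
        exact top_inf_eq _⟩
    (fun z hz => by rw [Set.mem_singleton_iff.1 hz, inf_top_eq, inf_top_eq]; exact hxy)
  exact ⟨Q, q, hQ, hq, hs, hne⟩

theorem IsVariety.mem_of_separated {V : Set Alg.{u}} (hV : IsVariety V) {A : Alg.{u}}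
    (hA : ∀ x y : A, x ≠ y → ∃ Q ∈ V, ∃ q : A → Q, IsHom q ∧ q x ≠ q y) : A ∈ V := by
  choose Q hQ q hq hne using hA
  refine hV.sub A (Alg.prod fun p : {p : A × A // p.1 ≠ p.2} => Q p.1.1 p.1.2 p.2)
    (hV.prod _ _ fun p => hQ _ _ _) (fun a p => q p.1.1 p.1.2 p.2 a)
    ⟨⟨fun a b => funext fun p => (hq _ _ p.2).map_sup a b,
      fun a b => funext fun p => (hq _ _ p.2).map_inf a b,
      fun a => funext fun p => (hq _ _ p.2).map_st a,
      fun a => funext fun p => (hq _ _ p.2).map_pr a,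
      funext fun p => (hq _ _ p.2).map_bot, funext fun p => (hq _ _ p.2).map_top⟩,
      fun a b hab => ?_⟩
  by_contra hne'
  exact hne a b hne' (congrFun hab ⟨(a, b), hne'⟩)

/-- A subvariety of `AG` is determined by the simple algebras it contains. -/
theorem subset_of_simple {V W : Set Alg.{u}} (hV : IsNontrivialSubvariety V AG)
    (hW : IsNontrivialSubvariety W AG) (h1 : threeDblst ∈ V → threeDblst ∈ W)
    (h2 : threeKlst ∈ V → threeKlst ∈ W) (h3 : fourDmba ∈ V → fourDmba ∈ W) : V ⊆ W := by
  intro A hA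
  refine hW.1.mem_of_separated fun x y hxy => ?_
  obtain ⟨Q, q, hQ, hq, hqs, hne⟩ := (hV.2.1 hA).exists_simple_quotient_separating hxy
  have hQV : Q ∈ V := hV.1.image A Q hA q hq hqs
  refine ⟨Q, ?_, q, hq, hne⟩
  rcases hQ.iso_cases with hi | hi | hi | hi
  · exact hi.mem hW.1 hW.two_mem
  · exact hi.mem hW.1 (h1 (hi.symm.mem hV.1 hQV))
  · exact hi.mem hW.1 (h2 (hi.symm.mem hV.1 hQV))
  · exact hi.mem hW.1 (h3 (hi.symm.mem hV.1 hQV))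

theorem eq_of_simple {V W : Set Alg.{u}} (hV : IsNontrivialSubvariety V AG)
    (hW : IsNontrivialSubvariety W AG) (h1 : threeDblst ∈ V ↔ threeDblst ∈ W)
    (h2 : threeKlst ∈ V ↔ threeKlst ∈ W) (h3 : fourDmba ∈ V ↔ fourDmba ∈ W) : V = W :=
  (subset_of_simple hV hW h1.1 h2.1 h3.1).antisymm (subset_of_simple hW hV h1.2 h2.2 h3.2)

/-- `V` is a nontrivial subvariety of `AG`, and `p`, `q`, `r` tell which of the three simple
algebras other than the two-element one it contains. -/
structure HasProfile (V : Set Alg.{u}) (p q r : Prop) : Prop where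
  sub : IsNontrivialSubvariety V AG
  dblst : threeDblst ∈ V ↔ p
  klst : threeKlst ∈ V ↔ q
  dmba : fourDmba ∈ V ↔ r

theorem HasProfile.unique {V W : Set Alg.{u}} {p q r : Prop} (hV : HasProfile V p q r)
    (hW : HasProfile W p q r) : V = W :=
  eq_of_simple hV.sub hW.sub (hV.dblst.trans hW.dblst.symm) (hV.klst.trans hW.klst.symm)
    (hV.dmba.trans hW.dmba.symm)

theorem hasProfile_BA : HasProfile BA.{u} False False False where
  sub := ⟨isVariety_BA, BA_subset_G.trans G_subset_AG, two, two_mem_BA, inferInstance⟩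
  dblst := iff_false_intro threeDblst_notMem_BA
  klst := iff_false_intro threeKlst_notMem_BA
  dmba := iff_false_intro fun h => fourDmba_notMem_G (BA_subset_G h)

theorem hasProfile_RDBLSt : HasProfile RDBLSt.{u} True False False where
  sub := ⟨isVariety_RDBLSt, RDBLSt_subset_G.trans G_subset_AG, threeDblst, threeDblst_mem_RDBLSt,
    inferInstance⟩
  dblst := iff_true_intro threeDblst_mem_RDBLSt
  klst := iff_false_intro threeKlst_notMem_RDBLSt
  dmba := iff_false_intro fun h => fourDmba_notMem_G (RDBLSt_subset_G h)

theorem hasProfile_RKLSt : HasProfile RKLSt.{u} False True False where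
  sub := ⟨isVariety_RKLSt, RKLSt_subset_G.trans G_subset_AG, threeKlst, threeKlst_mem_RKLSt,
    inferInstance⟩
  dblst := iff_false_intro threeDblst_notMem_RKLSt
  klst := iff_true_intro threeKlst_mem_RKLSt
  dmba := iff_false_intro fun h => fourDmba_notMem_G (RKLSt_subset_G h)

theorem isNontrivialSubvariety_generatedVariety {K : Set Alg.{u}} (hK : K ⊆ AG)
    (h4 : fourDmba ∈ K) : IsNontrivialSubvariety (generatedVariety K) AG :=
  ⟨isVariety_generatedVariety K, generatedVariety_subset isVariety_AG hK, fourDmba,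
    subset_generatedVariety K h4, inferInstance⟩

theorem hasProfile_DMBA : HasProfile DMBA.{u} False False True where
  sub := isNontrivialSubvariety_generatedVariety
    (Set.singleton_subset_iff.2 fourDmba_mem_AG) rfl
  dblst := iff_false_intro threeDblst_notMem_DMBA
  klst := iff_false_intro threeKlst_notMem_DMBA
  dmba := iff_true_intro (subset_generatedVariety _ rfl)

theorem hasProfile_G : HasProfile G.{u} True True False where
  sub := ⟨isVariety_G, G_subset_AG, threeDblst, threeDblst_mem_G, inferInstance⟩
  dblst := iff_true_intro threeDblst_mem_G
  klst := iff_true_intro threeKlst_mem_G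
  dmba := iff_false_intro fourDmba_notMem_G

theorem hasProfile_generatedVariety_threeDblst :
    HasProfile (generatedVariety.{u} {threeDblst, fourDmba}) True False True where
  sub := isNontrivialSubvariety_generatedVariety
    (Set.pair_subset threeDblst_mem_AG fourDmba_mem_AG) (Or.inr rfl)
  dblst := iff_true_intro (subset_generatedVariety _ (Or.inl rfl))
  klst := iff_false_intro threeKlst_notMem_generatedVariety
  dmba := iff_true_intro (subset_generatedVariety _ (Or.inr rfl))

theorem hasProfile_generatedVariety_threeKlst :
    HasProfile (generatedVariety.{u} {threeKlst, fourDmba}) False True True where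
  sub := isNontrivialSubvariety_generatedVariety
    (Set.pair_subset threeKlst_mem_AG fourDmba_mem_AG) (Or.inr rfl)
  dblst := iff_false_intro threeDblst_notMem_generatedVariety
  klst := iff_true_intro (subset_generatedVariety _ (Or.inl rfl))
  dmba := iff_true_intro (subset_generatedVariety _ (Or.inr rfl))

theorem hasProfile_AG : HasProfile AG.{u} True True True where
  sub := ⟨isVariety_AG, subset_rfl, threeDblst, threeDblst_mem_AG, inferInstance⟩
  dblst := iff_true_intro threeDblst_mem_AG
  klst := iff_true_intro threeKlst_mem_AG
  dmba := iff_true_intro fourDmba_mem_AG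

theorem exists_hasProfile (p q r : Prop) : ∃ V ∈ ({BA, RDBLSt, RKLSt, DMBA, G,
    generatedVariety {threeDblst, fourDmba}, generatedVariety {threeKlst, fourDmba}, AG} :
      Set (Set Alg.{u})), HasProfile V p q r := by
  by_cases hp : p <;> by_cases hq : q <;> by_cases hr : r <;> simp only [hp, hq, hr]
  exacts [⟨_, by simp, hasProfile_AG⟩, ⟨_, by simp, hasProfile_G⟩,
    ⟨_, by simp, hasProfile_generatedVariety_threeDblst⟩, ⟨_, by simp, hasProfile_RDBLSt⟩,
    ⟨_, by simp, hasProfile_generatedVariety_threeKlst⟩, ⟨_, by simp, hasProfile_RKLSt⟩,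
    ⟨_, by simp, hasProfile_DMBA⟩, ⟨_, by simp, hasProfile_BA⟩]

theorem nontrivialSubvarieties_eq :
    {V : Set Alg.{u} | IsNontrivialSubvariety V AG} =
      {BA, RDBLSt, RKLSt, DMBA, G, generatedVariety {threeDblst, fourDmba},
        generatedVariety {threeKlst, fourDmba}, AG} := by
  apply Set.Subset.antisymm
  · intro V hV
    obtain ⟨W, hW, hp⟩ :=
      exists_hasProfile.{u} (threeDblst.{u} ∈ V) (threeKlst.{u} ∈ V) (fourDmba.{u} ∈ V)
    rwa [HasProfile.unique ⟨hV, Iff.rfl, Iff.rfl, Iff.rfl⟩ hp]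
  · rintro V (rfl | rfl | rfl | rfl | rfl | rfl | rfl | rfl)
    exacts [hasProfile_BA.sub, hasProfile_RDBLSt.sub, hasProfile_RKLSt.sub, hasProfile_DMBA.sub,
      hasProfile_G.sub, hasProfile_generatedVariety_threeDblst.sub,
      hasProfile_generatedVariety_threeKlst.sub, hasProfile_AG.sub]

theorem ncard_nontrivialSubvarieties :
    {V : Set Alg.{u} | IsNontrivialSubvariety V AG}.ncard = 8 := by
  let φ : Set Alg.{u} → Prop × Prop × Prop := fun V =>
    (threeDblst ∈ V, threeKlst ∈ V, fourDmba ∈ V)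
  have hinj : Set.InjOn φ {V | IsNontrivialSubvariety V AG} := by
    intro V hV W hW hVW
    simp only [φ, Prod.mk.injEq, eq_iff_iff] at hVW
    exact eq_of_simple hV hW hVW.1 hVW.2.1 hVW.2.2
  have himg : φ '' {V | IsNontrivialSubvariety V AG} = Set.univ := by
    apply Set.eq_univ_of_forall
    rintro ⟨p, q, r⟩
    obtain ⟨V, -, hV⟩ := exists_hasProfile.{u} p q r
    exact ⟨V, hV.sub, by simp only [φ, hV.dblst, hV.klst, hV.dmba]⟩
  rw [← hinj.ncard_image, himg, Set.ncard_univ, Nat.card_prod, Nat.card_prod,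
    Nat.card_eq_fintype_card, Fintype.card_prop]

theorem IsHom.id {A : Type u} [Ops A] : IsHom (fun x : A => x) :=
  ⟨fun _ _ => rfl, fun _ _ => rfl, fun _ => rfl, fun _ => rfl, rfl, rfl⟩

theorem IsHom.comp {A : Type u} {B : Type v} {C : Type w} [Ops A] [Ops B] [Ops C] {g : B → C}
    {f : A → B} (hg : IsHom g) (hf : IsHom f) : IsHom fun x => g (f x) :=
  ⟨fun x y => by rw [hf.map_sup, hg.map_sup], fun x y => by rw [hf.map_inf, hg.map_inf],
    fun x => by rw [hf.map_st, hg.map_st], fun x => by rw [hf.map_pr, hg.map_pr],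
    by rw [hf.map_bot, hg.map_bot], by rw [hf.map_top, hg.map_top]⟩

/-- The simple algebras of `AG`, up to isomorphism. -/
def simples : Set Alg.{u} := {two, threeDblst, threeKlst, fourDmba}

theorem IsSimpleAG.exists_iso {Q : Alg.{u}} (h : IsSimpleAG Q) : ∃ S ∈ simples.{u}, Iso Q S := by
  rcases h.iso_cases with hi | hi | hi | hi
  exacts [⟨_, Or.inl rfl, hi.symm⟩, ⟨_, Or.inr (Or.inl rfl), hi.symm⟩,
    ⟨_, Or.inr (Or.inr (Or.inl rfl)), hi.symm⟩, ⟨_, Or.inr (Or.inr (Or.inr rfl)), hi.symm⟩]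

theorem IsAlmostGautama.exists_hom_simples {A : Alg.{u}} (h : IsAlmostGautama A) {x y : A}
    (hxy : x ≠ y) : ∃ S ∈ simples.{u}, ∃ f : A → S, IsHom f ∧ f x ≠ f y := by
  obtain ⟨Q, q, hQ, hq, -, hne⟩ := h.exists_simple_quotient_separating hxy
  obtain ⟨S, hS, g, hg, hb⟩ := hQ.exists_iso
  exact ⟨S, hS, fun x => g (q x), hg.comp hq, fun heq => hne (hb.1 heq)⟩

theorem IsAlmostGautama.eq_of_forall_hom {A : Alg.{u}} (h : IsAlmostGautama A) {x y : A}
    (hxy : ∀ S ∈ simples.{u}, ∀ f : A → S, IsHom f → f x = f y) : x = y := by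
  by_contra hne
  obtain ⟨S, hS, f, hf, hne'⟩ := h.exists_hom_simples hne
  exact hne' (hxy S hS f hf)

/-- A term that in the simple algebras takes the value `1` if `a = c` and `0` otherwise. -/
def eqv {A : Type u} [Ops A] (a c : A) : A :=
  (((a⋆ ⊓ c⋆) ⊔ (a⋆⋆ ⊓ c⋆⋆)) ⊓ ((a⋆ ⊓ c⋆) ⊔ (a⋆⋆ ⊓ c⋆⋆))´⋆) ⊓
    (((a ⊓ a´⋆) ⊓ (c ⊓ c´⋆)) ⊔ ((a ⊓ a´⋆)⋆ ⊓ (c ⊓ c´⋆)⋆))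

theorem IsHom.map_eqv {A : Type u} {B : Type v} [Ops A] [Ops B] {f : A → B} (hf : IsHom f)
    (a c : A) : f (eqv a c) = eqv (f a) (f c) := by
  simp only [eqv, hf.map_inf, hf.map_sup, hf.map_st, hf.map_pr]

theorem eqv_simples {S : Alg.{u}} (hS : S ∈ simples.{u}) :
    ∀ a c : S, a ⊓ eqv a c = c ⊓ eqv a c ∧ (eqv a c)⋆⋆ = eqv a c ∧ (eqv a c)´ = (eqv a c)⋆ ∧
      eqv a a = ⊤ := by
  rcases hS with rfl | rfl | rfl | rfl <;> decide

namespace IsAlmostGautama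
variable {A : Alg.{u}} (h : IsAlmostGautama A)
include h

theorem inf_eqv (a c : A) : a ⊓ eqv a c = c ⊓ eqv a c :=
  h.eq_of_forall_hom fun S hS f hf => by
    rw [hf.map_inf, hf.map_inf, hf.map_eqv]
    exact (eqv_simples hS _ _).1

theorem isCentral_eqv (a c : A) : IsCentral (eqv a c) where
  st_st := h.eq_of_forall_hom fun S hS f hf => by
    rw [hf.map_st, hf.map_st, hf.map_eqv]
    exact (eqv_simples hS _ _).2.1
  pr := h.eq_of_forall_hom fun S hS f hf => by
    rw [hf.map_st, hf.map_pr, hf.map_eqv]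
    exact (eqv_simples hS _ _).2.2.1

theorem eqv_self (a : A) : eqv a a = ⊤ :=
  h.eq_of_forall_hom fun S hS f hf => by
    rw [hf.map_eqv, hf.map_top]
    exact (eqv_simples hS _ (f a)).2.2.2

end IsAlmostGautama

section Amalgamation

variable {V : Set Alg.{u}} {S : Alg.{u}}

/-- If every simple member of `V` maps into `S` and homomorphisms into `S` are determined by their
kernels up to endomorphisms, then `S` is injective in `V`. -/
theorem exists_extension (hV : IsNontrivialSubvariety V AG) (hS : S ∈ AG) [Nontrivial S]
    (hcen : ∀ s : S, IsCentral s → s = ⊥ ∨ s = ⊤)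
    (hhom : ∀ Q ∈ V, IsSimpleAG Q → ∃ f : Q → S, IsHom f)
    (hker : ∀ (A : Alg.{u}) (h k : A → S), IsHom h → IsHom k → (∀ a c, h a = h c ↔ k a = k c) →
      ∃ σ : S → S, IsHom σ ∧ ∀ a, h a = σ (k a))
    {A C : Alg.{u}} (hA : A ∈ AG) (hC : C ∈ V) {g : A → C} (hg : IsEmb g) {h : A → S}
    (hh : IsHom h) : ∃ ψ : C → S, IsHom ψ ∧ ∀ a, ψ (g a) = h a := by
  have hCag : IsAlmostGautama C := hV.2.1 hC
  have hbt : (⊥ : S) ≠ ⊤ := IsAlmostGautama.bot_ne_top hS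
  let _ := hCag.stone.lattice
  let _ := hCag.stone.boundedOrder
  let _ := hS.stone.lattice
  let _ := hS.stone.boundedOrder
  have hF : IsCentralFilter (g '' {z | IsCentral z ∧ h z = ⊤}) := by
    refine ⟨?_, ⟨⊤, ⟨hA.isCentral_top, hh.map_top⟩, hg.1.map_top⟩, ?_⟩
    · rintro _ ⟨z, hz, rfl⟩
      exact hz.1.map hg.1
    · rintro _ ⟨z, hz, rfl⟩ _ ⟨w, hw, rfl⟩
      exact ⟨z ⊓ w, ⟨hA.isCentral_inf hz.1 hw.1, by rw [hh.map_inf, hz.2, hw.2, inf_idem]⟩,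
        hg.1.map_inf z w⟩
  have hproper : ∀ z ∈ g '' {z | IsCentral z ∧ h z = ⊤}, (⊥ : C) ⊓ z ≠ ⊤ ⊓ z := by
    rintro _ ⟨z, hz, rfl⟩ heq
    rw [bot_inf_eq, top_inf_eq, ← hg.1.map_bot] at heq
    apply hbt
    rw [← hh.map_bot, hg.2 heq, hz.2]
  obtain ⟨Q, q, hQ, hq, hqs, -, htop⟩ := hCag.exists_simple_quotient hF hproper
  obtain ⟨f, hf⟩ := hhom Q (hV.1.image C Q hC q hq hqs) hQ
  have hfq : IsHom fun x => f (q x) := hf.comp hq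
  have hk : IsHom fun a => f (q (g a)) := hfq.comp hg.1
  have hone : ∀ z, IsCentral z → h z = ⊤ → f (q (g z)) = ⊤ := fun z hz hz1 => by
    rw [htop _ ⟨z, ⟨hz, hz1⟩, rfl⟩, hf.map_top]
  have eq_of_top {k : A → S} (hk : IsHom k) {a c : A} (h1 : k (eqv a c) = ⊤) : k a = k c := by
    have := congrArg k (hA.inf_eqv a c)
    rwa [hk.map_inf, hk.map_inf, h1, inf_top_eq, inf_top_eq] at this
  obtain ⟨σ, hσ, hσk⟩ := hker A h (fun a => f (q (g a))) hh hk fun a c => by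
    constructor
    · intro hac
      refine eq_of_top hk (hone _ (hA.isCentral_eqv a c) ?_)
      rw [hh.map_eqv, hac, hS.eqv_self]
    · intro hac
      rcases hcen _ ((hA.isCentral_eqv a c).map hh) with h0 | h1
      · exfalso
        have h2 : f (q (g (eqv a c)⋆)) = ⊤ := by
          apply hone _ (hA.isCentral_st (hA.isCentral_eqv a c))
          rw [hh.map_st, h0, hS.stone.bot_st]
        have h3 : f (q (g (eqv a c))) = ⊤ := by
          rw [hk.map_eqv, hac, hS.eqv_self]
        rw [hk.map_st, h3, hS.stone.top_st] at h2
        exact hbt h2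
      · exact eq_of_top hh h1
  exact ⟨fun x => σ (f (q x)), hσ.comp hfq, fun a => (hσk a).symm⟩

theorem exists_hom_separating (hV : IsNontrivialSubvariety V AG) {B : Alg.{u}} (hB : B ∈ V)
    (hemb : ∀ Q ∈ V, IsSimpleAG Q → ∃ f : Q → S, IsEmb f) {x y : B} (hxy : x ≠ y) :
    ∃ φ : B → S, IsHom φ ∧ φ x ≠ φ y := by
  obtain ⟨Q, q, hQ, hq, hqs, hne⟩ := (hV.2.1 hB).exists_simple_quotient_separating hxy
  obtain ⟨f, hf⟩ := hemb Q (hV.1.image B Q hB q hq hqs) hQ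
  exact ⟨fun x => f (q x), hf.1.comp hq, fun heq => hne (hf.2 heq)⟩

theorem hasAP_of_simple (hV : IsNontrivialSubvariety V AG) (hSV : S ∈ V) [Nontrivial S]
    (hcen : ∀ s : S, IsCentral s → s = ⊥ ∨ s = ⊤)
    (hemb : ∀ Q ∈ V, IsSimpleAG Q → ∃ f : Q → S, IsEmb f)
    (hker : ∀ (A : Alg.{u}) (h k : A → S), IsHom h → IsHom k → (∀ a c, h a = h c ↔ k a = k c) →
      ∃ σ : S → S, IsHom σ ∧ ∀ a, h a = σ (k a)) : HasAP V := by
  intro A hA B hB C hC f g hf hg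
  have hext {B C : Alg.{u}} {f : A → B} {g : A → C} (hC : C ∈ V) (hf : IsEmb f) (hg : IsEmb g)
      {φ : B → S} (hφ : IsHom φ) : ∃ ψ : C → S, IsHom ψ ∧ ∀ a, ψ (g a) = φ (f a) :=
    exists_extension hV (hV.2.1 hSV) hcen
      (fun Q hQ hs => (hemb Q hQ hs).imp fun _ h => h.1) hker (hV.2.1 hA) hC hg (hφ.comp hf.1)
  let I : Type u := {p : (B → S) × (C → S) // IsHom p.1 ∧ IsHom p.2 ∧ ∀ a, p.1 (f a) = p.2 (g a)}
  refine ⟨Alg.prod fun _ : I => S, hV.1.prod _ _ fun _ => hSV, fun b p => p.1.1 b,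
    fun c p => p.1.2 c, ⟨⟨fun x y => funext fun p => p.2.1.map_sup x y,
      fun x y => funext fun p => p.2.1.map_inf x y, fun x => funext fun p => p.2.1.map_st x,
      fun x => funext fun p => p.2.1.map_pr x, funext fun p => p.2.1.map_bot,
      funext fun p => p.2.1.map_top⟩, fun x y hxy => ?_⟩,
    ⟨⟨fun x y => funext fun p => p.2.2.1.map_sup x y,
      fun x y => funext fun p => p.2.2.1.map_inf x y, fun x => funext fun p => p.2.2.1.map_st x,
      fun x => funext fun p => p.2.2.1.map_pr x, funext fun p => p.2.2.1.map_bot,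
      funext fun p => p.2.2.1.map_top⟩, fun x y hxy => ?_⟩,
    funext fun a => funext fun p => p.2.2.2 a⟩
  · by_contra hne
    obtain ⟨φ, hφ, hφne⟩ := exists_hom_separating hV hB hemb hne
    obtain ⟨ψ, hψ, hcomp⟩ := hext hC hf hg hφ
    exact hφne (congrFun hxy (⟨(φ, ψ), hφ, hψ, fun a => (hcomp a).symm⟩ : I))
  · by_contra hne
    obtain ⟨φ, hφ, hφne⟩ := exists_hom_separating hV hC hemb hne
    obtain ⟨ψ, hψ, hcomp⟩ := hext hB hg hf hφ
    exact hφne (congrFun hxy (⟨(ψ, φ), hψ, hφ, hcomp⟩ : I))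

theorem exists_emb_of_forall (hV : IsNontrivialSubvariety V AG) (hSV : S ∈ V) [Nontrivial S]
    (hmem : ∀ T ∈ simples.{u}, T ∈ V → T = two ∨ T = S) :
    ∀ Q ∈ V, IsSimpleAG Q → ∃ f : Q → S, IsEmb f := by
  intro Q hQV hQ
  obtain ⟨T, hT, hi⟩ := hQ.exists_iso
  rcases hmem T hT (hi.mem hV.1 hQV) with rfl | rfl
  · obtain ⟨g, hg, hb⟩ := hi
    obtain ⟨f, hf⟩ := exists_emb_two (hV.2.1 hSV)
    exact ⟨fun x => f (g x), hf.1.comp hg, hf.2.comp hb.1⟩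
  · obtain ⟨g, hg, hb⟩ := hi
    exact ⟨g, hg, hb.1⟩

theorem exists_endo_of_chain (hall : ∃ m : S, ∀ s : S, s = ⊥ ∨ s = m ∨ s = ⊤) (A : Alg.{u})
    (h k : A → S) (hh : IsHom h) (hk : IsHom k) (hker : ∀ a c, h a = h c ↔ k a = k c) :
    ∃ σ : S → S, IsHom σ ∧ ∀ a, h a = σ (k a) := by
  obtain ⟨m, hall⟩ := hall
  refine ⟨fun s => s, IsHom.id, fun a => ?_⟩
  have h0 := hker a ⊥
  have h1 := hker a ⊤
  rw [hh.map_bot, hk.map_bot] at h0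
  rw [hh.map_top, hk.map_top] at h1
  rcases hall (h a) with ha | ha | ha
  · rw [ha, h0.1 ha]
  · rcases hall (k a) with hb | hb | hb
    · rw [h0.2 hb, hb]
    · rw [ha, hb]
    · rw [h1.2 hb, hb]
  · rw [ha, h1.1 ha]

/-- The automorphism of `𝟒_dmba` exchanging the atoms. -/
def swapAtoms (x : fourDmba.{u}) : fourDmba.{u} := (⟨x.down.swap⟩ : ULift (Bool × Bool))

theorem isHom_swapAtoms : IsHom swapAtoms.{u} := by
  refine ⟨?_, ?_, ?_, ?_, ?_, ?_⟩ <;> decide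

theorem exists_endo_fourDmba (A : Alg.{u}) (h k : A → fourDmba.{u}) (hh : IsHom h) (hk : IsHom k)
    (hker : ∀ a c, h a = h c ↔ k a = k c) :
    ∃ σ : fourDmba.{u} → fourDmba.{u}, IsHom σ ∧ ∀ a, h a = σ (k a) := by
  have hcases : ∀ p s t : fourDmba.{u}, ¬ (s = ⊥ ∨ s = ⊤) → ¬ (t = ⊥ ∨ t = ⊤) →
      (s = t ∨ s = swapAtoms t) ∧ (p = ⊥ ∨ p = ⊤ ∨ p = t ∨ p = t⋆) := by decide
  have hconst : ∀ a, (k a = ⊥ → h a = ⊥) ∧ (k a = ⊤ → h a = ⊤) ∧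
      (h a = ⊥ ∨ h a = ⊤ → k a = ⊥ ∨ k a = ⊤) := by
    intro a
    have h0 := hker a ⊥
    have h1 := hker a ⊤
    rw [hh.map_bot, hk.map_bot] at h0
    rw [hh.map_top, hk.map_top] at h1
    exact ⟨h0.2, h1.2, Or.imp h0.1 h1.1⟩
  by_cases hex : ∃ a, ¬ (k a = ⊥ ∨ k a = ⊤)
  · obtain ⟨a, ha⟩ := hex
    have main : ∀ σ : fourDmba.{u} → fourDmba.{u}, IsHom σ → h a = σ (k a) →
        ∀ c, h c = σ (k c) := by
      intro σ hσ hσa c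
      rcases (hcases (k c) _ _ ha ha).2 with hc | hc | hc | hc
      · rw [hc, hσ.map_bot, (hconst c).1 hc]
      · rw [hc, hσ.map_top, (hconst c).2.1 hc]
      · rw [hc, ← hσa, hker, hc]
      · rw [hc, hσ.map_st, ← hσa, ← hh.map_st, hker, hc, hk.map_st]
    rcases (hcases ⊥ (h a) (k a) (fun hc => ha ((hconst a).2.2 hc)) ha).1 with he | he
    · exact ⟨fun s => s, IsHom.id, main _ IsHom.id he⟩
    · exact ⟨swapAtoms, isHom_swapAtoms, main _ isHom_swapAtoms he⟩
  · push Not at hex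
    refine ⟨fun s => s, IsHom.id, fun a => ?_⟩
    rcases hex a with hc | hc
    · rw [hc, (hconst a).1 hc]
    · rw [hc, (hconst a).2.1 hc]

theorem isCentral_simples {S : Alg.{u}} (hS : S ∈ simples.{u}) (s : S) (hs : IsCentral s) :
    s = ⊥ ∨ s = ⊤ := by
  have key : ∀ s : S, s⋆⋆ = s → s´ = s⋆ → s = ⊥ ∨ s = ⊤ := by
    rcases hS with rfl | rfl | rfl | rfl <;> decide
  exact key s hs.st_st hs.pr

theorem hasAP_BA : HasAP BA.{u} := by
  refine hasAP_of_simple hasProfile_BA.sub two_mem_BA (isCentral_simples (Or.inl rfl))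
    (exists_emb_of_forall hasProfile_BA.sub two_mem_BA ?_) (exists_endo_of_chain (by decide))
  rintro T (rfl | rfl | rfl | rfl) hT
  exacts [Or.inl rfl, (hasProfile_BA.dblst.1 hT).elim, (hasProfile_BA.klst.1 hT).elim,
    (hasProfile_BA.dmba.1 hT).elim]

theorem hasAP_RDBLSt : HasAP RDBLSt.{u} := by
  refine hasAP_of_simple hasProfile_RDBLSt.sub threeDblst_mem_RDBLSt
    (isCentral_simples (Or.inr (Or.inl rfl)))
    (exists_emb_of_forall hasProfile_RDBLSt.sub threeDblst_mem_RDBLSt ?_)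
    (exists_endo_of_chain (by decide))
  rintro T (rfl | rfl | rfl | rfl) hT
  exacts [Or.inl rfl, Or.inr rfl, (hasProfile_RDBLSt.klst.1 hT).elim,
    (hasProfile_RDBLSt.dmba.1 hT).elim]

theorem hasAP_RKLSt : HasAP RKLSt.{u} := by
  refine hasAP_of_simple hasProfile_RKLSt.sub threeKlst_mem_RKLSt
    (isCentral_simples (Or.inr (Or.inr (Or.inl rfl))))
    (exists_emb_of_forall hasProfile_RKLSt.sub threeKlst_mem_RKLSt ?_)
    (exists_endo_of_chain (by decide))
  rintro T (rfl | rfl | rfl | rfl) hT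
  exacts [Or.inl rfl, (hasProfile_RKLSt.dblst.1 hT).elim, Or.inr rfl,
    (hasProfile_RKLSt.dmba.1 hT).elim]

theorem hasAP_DMBA : HasAP DMBA.{u} := by
  have hmem := hasProfile_DMBA.{u}.dmba.2 trivial
  refine hasAP_of_simple hasProfile_DMBA.sub hmem
    (isCentral_simples (Or.inr (Or.inr (Or.inr rfl))))
    (exists_emb_of_forall hasProfile_DMBA.sub hmem ?_) exists_endo_fourDmba
  rintro T (rfl | rfl | rfl | rfl) hT
  exacts [Or.inl rfl, (hasProfile_DMBA.dblst.1 hT).elim, (hasProfile_DMBA.klst.1 hT).elim,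
    Or.inr rfl]

/-- Two members without homomorphisms into a common simple algebra have no amalgam over the
two-element algebra. -/
theorem not_hasAP (hV : IsNontrivialSubvariety V AG) {B C : Alg.{u}} (hB : B ∈ V) (hC : C ∈ V)
    [Nontrivial B] [Nontrivial C]
    (hBC : ∀ S ∈ simples.{u}, ∀ (φ : B → S) (ψ : C → S), IsHom φ → ¬ IsHom ψ) : ¬ HasAP V := by
  intro hAP
  obtain ⟨f, hf⟩ := exists_emb_two (hV.2.1 hB)
  obtain ⟨g, hg⟩ := exists_emb_two (hV.2.1 hC)
  obtain ⟨D, hD, f₁, g₁, hf₁, hg₁, -⟩ := hAP two hV.two_mem B hB C hC f g hf hg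
  obtain ⟨x, y, hxy⟩ := exists_pair_ne B
  obtain ⟨S, hS, k, hk, -⟩ := (hV.2.1 hD).exists_hom_simples (hf₁.2.ne hxy)
  exact hBC S hS _ _ (hk.comp hf₁.1) (hk.comp hg₁.1)

theorem IsHom.threeDblst_image {φ : threeDblst.{u} → S} (hφ : IsHom φ) :
    ∃ x : S, x⋆ = ⊥ ∧ x´ = ⊤ := by
  obtain ⟨a, h1, h2⟩ : ∃ a : threeDblst.{u}, a⋆ = ⊥ ∧ a´ = ⊤ := by decide
  exact ⟨φ a, by rw [← hφ.map_st, h1, hφ.map_bot], by rw [← hφ.map_pr, h2, hφ.map_top]⟩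

theorem IsHom.threeKlst_image {φ : threeKlst.{u} → S} (hφ : IsHom φ) :
    ∃ x : S, x⋆ = ⊥ ∧ x´ = x := by
  obtain ⟨a, h1, h2⟩ : ∃ a : threeKlst.{u}, a⋆ = ⊥ ∧ a´ = a := by decide
  exact ⟨φ a, by rw [← hφ.map_st, h1, hφ.map_bot], by rw [← hφ.map_pr, h2]⟩

theorem IsHom.fourDmba_image {φ : fourDmba.{u} → S} (hφ : IsHom φ) :
    ∃ x : S, x⋆⋆ = x ∧ x´ = x := by
  obtain ⟨a, h1, h2⟩ : ∃ a : fourDmba.{u}, a⋆⋆ = a ∧ a´ = a := by decide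
  exact ⟨φ a, by rw [← hφ.map_st, ← hφ.map_st, h1], by rw [← hφ.map_pr, h2]⟩

theorem not_hasAP_of_threes (hV : IsNontrivialSubvariety V AG) (hB : threeDblst ∈ V)
    (hC : threeKlst ∈ V) : ¬ HasAP V := by
  refine not_hasAP hV hB hC fun S hS φ ψ hφ hψ => ?_
  have h1 := hφ.threeDblst_image
  have h2 := hψ.threeKlst_image
  clear hφ hψ
  rcases hS with rfl | rfl | rfl | rfl <;> revert h1 h2 <;> decide

theorem not_hasAP_of_threeDblst (hV : IsNontrivialSubvariety V AG) (hB : threeDblst ∈ V)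
    (hC : fourDmba ∈ V) : ¬ HasAP V := by
  refine not_hasAP hV hB hC fun S hS φ ψ hφ hψ => ?_
  have h1 := hφ.threeDblst_image
  have h2 := hψ.fourDmba_image
  clear hφ hψ
  rcases hS with rfl | rfl | rfl | rfl <;> revert h1 h2 <;> decide

theorem not_hasAP_of_threeKlst (hV : IsNontrivialSubvariety V AG) (hB : threeKlst ∈ V)
    (hC : fourDmba ∈ V) : ¬ HasAP V := by
  refine not_hasAP hV hB hC fun S hS φ ψ hφ hψ => ?_
  have h1 := hφ.threeKlst_image
  have h2 := hψ.fourDmba_image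
  clear hφ hψ
  rcases hS with rfl | rfl | rfl | rfl <;> revert h1 h2 <;> decide

end Amalgamation

end AlmostGautama

theorem theorem3p24 :
    -- the nontrivial subvarieties of `AG` are the following eight, pairwise different, classes
    {V : Set Alg.{u} | IsNontrivialSubvariety V AG} =
      {BA, RDBLSt, RKLSt, DMBA, G, generatedVariety {threeDblst, fourDmba},
        generatedVariety {threeKlst, fourDmba}, AG} ∧
    {V : Set Alg.{u} | IsNontrivialSubvariety V AG}.ncard = 8 ∧
    -- four of them have the Amalgamation Property
    (∀ V ∈ ({BA, RDBLSt, RKLSt, DMBA} : Set (Set Alg.{u})), HasAP V) ∧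
    -- the other four do not have it
    (∀ V ∈ ({G, generatedVariety {threeDblst, fourDmba},
        generatedVariety {threeKlst, fourDmba}, AG} : Set (Set Alg.{u})), ¬ HasAP V) := by
  refine ⟨nontrivialSubvarieties_eq, ncard_nontrivialSubvarieties, ?_, ?_⟩
  · rintro V (rfl | rfl | rfl | rfl)
    exacts [hasAP_BA, hasAP_RDBLSt, hasAP_RKLSt, hasAP_DMBA]
  · rintro V (rfl | rfl | rfl | rfl)
    exacts [not_hasAP_of_threes hasProfile_G.sub threeDblst_mem_G threeKlst_mem_G,
      not_hasAP_of_threeDblst hasProfile_generatedVariety_threeDblst.sub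
        (hasProfile_generatedVariety_threeDblst.dblst.2 trivial)
        (hasProfile_generatedVariety_threeDblst.dmba.2 trivial),
      not_hasAP_of_threeKlst hasProfile_generatedVariety_threeKlst.sub
        (hasProfile_generatedVariety_threeKlst.klst.2 trivial)
        (hasProfile_generatedVariety_threeKlst.dmba.2 trivial),
      not_hasAP_of_threes hasProfile_AG.sub threeDblst_mem_AG threeKlst_mem_AG]
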